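/- Let $K$ be an algebraically closed field of any characteristic, let $n\ge 1$, and let $\mathbb G_m^n=(K\setminus\{0\})^n$ with coordinatewise multiplication. A subset of $\mathbb G_m^n$ is called algebraic if it is the set of common zeros in $\mathbb G_m^n$ of finitely many Laurent polynomials in $K[X_1^{\pm1},\dots,X_n^{\pm1}]$; the algebraic subsets are the closed sets of the Zariski topology, and irreducibility and (Krull) dimension are taken with respect to it. A torsion coset is a set $\boldsymbol\zeta G$, where $\boldsymbol\zeta\in\mathbb G_m^n$ has finite order and $G<\mathbb G_m^n$ is an irreducible algebraic subgroup. An algebraic set $X\subset\mathbb G_m^n$ is called admissible if it is finite, or if $\dim X\ge 1$ and $X$ contains no torsion coset of dimension $\dim X$. For real $T\ge 1$ let $X_T$ be the set of all $\boldsymbol\zeta\in X$ that have finite order at most $T$ in the group $\mathbb G_m^n$. Let $X\subset\mathbb G_m^n$ be algebraic, irreducible, admissible and of dimension $d$. Then there is a constant $c=c(X)$ such that for all real $T\ge 1$ the set $X_T$ is finite and $$\#X_T\le c\,T^{\,d+1-\frac1{d+1}}.$$ -/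

import Mathlib

namespace GmTorsion

/-- The group `𝔾ₘⁿ(K) = (K ∖ {0})ⁿ` of `K`-points of the `n`-dimensional algebraic torus, with
coordinatewise multiplication. -/
abbrev Torus (n : ℕ) (K : Type*) [Field K] : Type _ := Fin n → Kˣ

/-- The ring `K[X₁^{±1}, …, Xₙ^{±1}]` of Laurent polynomials: finitely supported families of
coefficients indexed by the exponents in `ℤⁿ`, with the convolution product. -/
abbrev Laurent (n : ℕ) (K : Type*) [Field K] : Type _ := AddMonoidAlgebra K (Fin n → ℤ)

/-- The value `x^v = x₁^{v₁} ⋯ xₙ^{vₙ}` of a monomial with exponent `v`, multiplicative in `v`. -/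
noncomputable def monomialHom {n : ℕ} {K : Type*} [Field K] (x : Torus n K) :
    Multiplicative (Fin n → ℤ) →* K where
  toFun v := ((∏ i, x i ^ (v.toAdd i) : Kˣ) : K)
  map_one' := by simp
  map_mul' v w := by simp [zpow_add, Finset.prod_mul_distrib]

/-- Evaluation of Laurent polynomials at a point of the torus. -/
noncomputable def eval {n : ℕ} {K : Type*} [Field K] (x : Torus n K) : Laurent n K →ₐ[K] K :=
  AddMonoidAlgebra.lift K K (Fin n → ℤ) (monomialHom x)

theorem eval_apply {n : ℕ} {K : Type*} [Field K] (x : Torus n K) (P : Laurent n K) :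
    eval x P = P.coeff.sum fun v a => a * ((∏ i, x i ^ v i : Kˣ) : K) := by
  simp [eval, AddMonoidAlgebra.lift_apply, monomialHom]

/-- Algebraic subsets of `𝔾ₘⁿ`: the common zero sets of finitely many Laurent polynomials. -/
def IsAlgebraic {n : ℕ} {K : Type*} [Field K] (X : Set (Torus n K)) : Prop :=
  ∃ S : Finset (Laurent n K), X = {x | ∀ P ∈ S, eval x P = 0}

theorem isNoetherianRing_laurent (n : ℕ) (K : Type*) [Field K] :
    IsNoetherianRing (Laurent n K) := by
  have : Algebra.FiniteType K (Laurent n K) := inferInstance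
  exact Algebra.FiniteType.isNoetherianRing K _

theorem isAlgebraic_zeroLocus {n : ℕ} {K : Type*} [Field K] (S : Set (Laurent n K)) :
    IsAlgebraic {x : Torus n K | ∀ P ∈ S, eval x P = 0} := by
  have := isNoetherianRing_laurent n K
  obtain ⟨F, hF⟩ := (isNoetherianRing_iff_ideal_fg _).1 this (Ideal.span S)
  have key : ∀ (A : Set (Laurent n K)) (x : Torus n K),
      (∀ P ∈ A, eval x P = 0) ↔ Ideal.span A ≤ RingHom.ker (eval x) := by
    intro A x
    rw [Ideal.span_le]
    rfl
  refine ⟨F, Set.ext fun x => ?_⟩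
  have h1 := key S x
  have h2 := key (F : Set (Laurent n K)) x
  simp only [Set.mem_ofPred_eq]
  rw [h1, ← hF, ← h2]
  rfl

theorem isAlgebraic_empty {n : ℕ} {K : Type*} [Field K] :
    IsAlgebraic (∅ : Set (Torus n K)) :=
  ⟨{1}, by ext x; simp⟩

theorem isAlgebraic_sInter {n : ℕ} {K : Type*} [Field K] (A : Set (Set (Torus n K)))
    (hA : A ⊆ {X | IsAlgebraic X}) : IsAlgebraic (⋂₀ A) := by
  convert isAlgebraic_zeroLocus {P : Laurent n K | ∃ X ∈ A, ∀ x ∈ X, eval x P = 0} using 1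
  ext x
  constructor
  · rintro hx P ⟨X, hX, hP⟩
    exact hP x (hx X hX)
  · intro hx X hX
    obtain ⟨S, rfl⟩ := hA hX
    intro P hP
    exact hx P ⟨_, hX, fun y hy => hy P hP⟩

theorem isAlgebraic_union {n : ℕ} {K : Type*} [Field K] (X : Set (Torus n K))
    (hX : IsAlgebraic X) (Y : Set (Torus n K)) (hY : IsAlgebraic Y) : IsAlgebraic (X ∪ Y) := by
  obtain ⟨S, rfl⟩ := hX
  obtain ⟨S', rfl⟩ := hY
  convert isAlgebraic_zeroLocus {R : Laurent n K | ∃ P ∈ S, ∃ Q ∈ S', R = P * Q} using 1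
  ext x
  constructor
  · rintro (hx | hx) R ⟨P, hP, Q, hQ, rfl⟩
    · simp [hx P hP]
    · simp [hx Q hQ]
  · intro hx
    by_contra hcon
    simp only [Set.mem_union, Set.mem_ofPred_eq, not_or, not_forall] at hcon
    obtain ⟨⟨P, hP, hP0⟩, Q, hQ, hQ0⟩ := hcon
    have := hx (P * Q) ⟨P, hP, Q, hQ, rfl⟩
    rw [map_mul] at this
    exact (mul_ne_zero hP0 hQ0) this

/-- The Zariski topology on `𝔾ₘⁿ`: the closed sets are exactly the algebraic subsets. -/
instance zariskiTopology (n : ℕ) (K : Type*) [Field K] : TopologicalSpace (Torus n K) :=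
  TopologicalSpace.ofClosed {X | IsAlgebraic X} isAlgebraic_empty isAlgebraic_sInter
    isAlgebraic_union

theorem isClosed_iff {n : ℕ} {K : Type*} [Field K] (X : Set (Torus n K)) :
    IsClosed X ↔ IsAlgebraic X := by
  rw [← isOpen_compl_iff]
  change Xᶜᶜ ∈ {X | IsAlgebraic X} ↔ _
  rw [compl_compl]
  rfl

/-- The dimension of a subset of `𝔾ₘⁿ`: the Krull dimension of the subspace, for the Zariski
topology. -/
noncomputable def dim {n : ℕ} {K : Type*} [Field K] (X : Set (Torus n K)) : WithBot ℕ∞ :=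
  topologicalKrullDim X

/-- A linear torus is an irreducible algebraic subgroup of `𝔾ₘⁿ`. -/
def IsLinearTorus {n : ℕ} {K : Type*} [Field K] (G : Subgroup (Torus n K)) : Prop :=
  IsAlgebraic (G : Set (Torus n K)) ∧ IsIrreducible (G : Set (Torus n K))

/-- A torsion coset is a translate `ζG` of a linear torus `G` by a torsion point `ζ`. -/
def IsTorsionCoset {n : ℕ} {K : Type*} [Field K] (C : Set (Torus n K)) : Prop :=
  ∃ (ζ : Torus n K) (G : Subgroup (Torus n K)),
    IsOfFinOrder ζ ∧ IsLinearTorus G ∧ C = (fun g => ζ * g) '' (G : Set (Torus n K))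

/-- A set is admissible if it is finite, or if it has positive dimension and contains no torsion
coset of the same dimension. -/
def IsAdmissible {n : ℕ} {K : Type*} [Field K] (X : Set (Torus n K)) : Prop :=
  X.Finite ∨ (1 ≤ dim X ∧ ∀ C : Set (Torus n K), IsTorsionCoset C → C ⊆ X → dim C ≠ dim X)

/-- The set `X_T` of torsion points in `X` of order at most `T`. -/
def torsionUpTo {n : ℕ} {K : Type*} [Field K] (X : Set (Torus n K)) (T : ℝ) :
    Set (Torus n K) :=
  {ζ | ζ ∈ X ∧ IsOfFinOrder ζ ∧ (orderOf ζ : ℝ) ≤ T}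

end GmTorsion

/-!
Let `η` be a torsion point of order `N ≤ T` on a torus of dimension `k`. By Dirichlet's theorem on
simultaneous approximation, some power `η ^ g` lies on a one-parameter subgroup `t ↦ (t ^ aᵢ)` with
`a` primitive and `g * |aᵢ| ≤ Q`, where `Q = 2 * T ^ (1 - 1 / k)`. A Laurent polynomial whose Newton
polytope is full-dimensional restricts to each translate of this subgroup as a one-variable
polynomial of degree `O(Q / g)`, nonzero if some zero on the translate annihilates no proper partial
sum of its terms. There are `O((Q / g) ^ k)` vectors `a` and `g ^ (k - 1)` translates, and summing
over `g` leaves `O(Q ^ (k + 1)) = O(T ^ (k - 1 / k))` such torsion zeros of order at most `T`.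

If `X` contains a torsion point and is not a torsion coset, there are monomials that are linearly
independent modulo those constant on `X` but algebraically dependent on `X`. In a shortest such
family of `k = p + 1` monomials, every relation has a full-dimensional Newton polytope, and for a
relation with the fewest terms the points of `X` annihilating a proper partial sum form a smaller
closed subset, which carries only `O(T ^ d)` torsion points. The first `p` monomials complete to a
transcendence basis of `m ≤ d` monomials, with finite generic fibres; the `m - p` additional ones
contribute a factor `T ^ (m - p)`, for a total of `O(T ^ (m + 1 - 1 / (p + 1)))`.
-/

namespace GmTorsion

open TopologicalSpace
open scoped Matrix

/-- `S` is finite with at most `r` elements; the junk value `Set.ncard S = 0` of an infinite set is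
ruled out, and real bounds are allowed so that no rounding is needed. -/
def HasCardLE {α : Type*} (S : Set α) (r : ℝ) : Prop :=
  S.Finite ∧ (S.ncard : ℝ) ≤ r

namespace HasCardLE

variable {α β : Type*} {S S' : Set α} {T : Set β} {r r' t : ℝ}

theorem nonneg (h : HasCardLE S r) : 0 ≤ r :=
  (Nat.cast_nonneg _).trans h.2

theorem mono (h : HasCardLE S r) (hS : S' ⊆ S) (hr : r ≤ r') : HasCardLE S' r' :=
  ⟨h.1.subset hS, (Nat.cast_le.2 (Set.ncard_le_ncard hS h.1)).trans (h.2.trans hr)⟩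

theorem empty (hr : 0 ≤ r) : HasCardLE (∅ : Set α) r :=
  ⟨Set.finite_empty, by simpa using hr⟩

theorem coe_finset (s : Finset α) : HasCardLE (s : Set α) s.card :=
  ⟨s.finite_toSet, by rw [Set.ncard_coe_finset]⟩

theorem union (h : HasCardLE S r) (h' : HasCardLE S' r') : HasCardLE (S ∪ S') (r + r') :=
  ⟨h.1.union h'.1, (Nat.cast_le.2 (Set.ncard_union_le S S')).trans
    (by rw [Nat.cast_add]; exact add_le_add h.2 h'.2)⟩

theorem biUnion {s : Finset β} {f : β → Set α} {r : β → ℝ}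
    (h : ∀ b ∈ s, HasCardLE (f b) (r b)) : HasCardLE (⋃ b ∈ s, f b) (∑ b ∈ s, r b) := by
  refine ⟨s.finite_toSet.biUnion fun b hb => (h b hb).1, ?_⟩
  calc ((⋃ b ∈ s, f b).ncard : ℝ) ≤ (∑ b ∈ s, (f b).ncard : ℕ) :=
        Nat.cast_le.2 (Finset.set_ncard_biUnion_le s f)
    _ ≤ ∑ b ∈ s, r b := by
        rw [Nat.cast_sum]
        exact Finset.sum_le_sum fun b hb => (h b hb).2

theorem of_fibers (hT : HasCardLE T t) (f : α → β) (hf : Set.MapsTo f S T) (hr : 0 ≤ r)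
    (h : ∀ b ∈ T, HasCardLE {x ∈ S | f x = b} r) : HasCardLE S (t * r) := by
  obtain ⟨hfin, ht⟩ := hT
  lift T to Finset β using hfin
  rw [Set.ncard_coe_finset] at ht
  refine (biUnion h).mono (fun x hx => Set.mem_biUnion (hf hx) ⟨hx, rfl⟩) ?_
  rw [Finset.sum_const, nsmul_eq_mul]
  exact mul_le_mul_of_nonneg_right ht hr

theorem of_injOn (hT : HasCardLE T t) {f : α → β} (hf : Set.MapsTo f S T)
    (hinj : Set.InjOn f S) : HasCardLE S t := by
  rw [← mul_one t]
  refine hT.of_fibers f hf zero_le_one fun b _ => ?_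
  have hsub : {x ∈ S | f x = b}.Subsingleton :=
    fun x hx y hy => hinj hx.1 hy.1 (hx.2.trans hy.2.symm)
  have := hsub.finite.to_subtype
  exact ⟨hsub.finite, mod_cast Set.ncard_le_one_iff_subsingleton.2 hsub⟩

theorem pi {ι : Type*} [Fintype ι] {S : ι → Set α} {r : ι → ℝ}
    (h : ∀ i, HasCardLE (S i) (r i)) : HasCardLE {x : ι → α | ∀ i, x i ∈ S i} (∏ i, r i) := by
  classical
  choose hfin hr using h
  lift S to ι → Finset α using hfin
  simp only [Set.ncard_coe_finset] at hr
  have hS : {x : ι → α | ∀ i, x i ∈ (S i : Set α)} = (Fintype.piFinset S : Finset _) := by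
    ext x
    simp
  rw [hS]
  refine (coe_finset _).mono subset_rfl ?_
  rw [Fintype.card_piFinset, Nat.cast_prod]
  exact Finset.prod_le_prod (fun i _ => Nat.cast_nonneg _) fun i _ => hr i

end HasCardLE

theorem closed_induction {α : Type*} [TopologicalSpace α] [NoetherianSpace α] {P : Set α → Prop}
    (empty : P ∅) (union : ∀ X Y, IsClosed X → IsClosed Y → P X → P Y → P (X ∪ Y))
    (irreducible : ∀ X, IsClosed X → IsIrreducible X → (∀ Y, IsClosed Y → Y ⊂ X → P Y) → P X)
    {X : Set α} (hX : IsClosed X) : P X := by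
  suffices ∀ C : Closeds α, P C from this ⟨X, hX⟩
  intro C
  induction C using WellFoundedLT.induction with
  | ind C ih =>
    have ih' : ∀ Y, IsClosed Y → Y ⊂ (C : Set α) → P Y := fun Y hY hYC => ih ⟨Y, hY⟩ hYC
    by_cases hC : IsIrreducible (C : Set α)
    · exact irreducible C C.isClosed hC ih'
    rcases (C : Set α).eq_empty_or_nonempty with h | hne
    · rwa [h]
    have : ¬ IsPreirreducible (C : Set α) := fun h => hC ⟨hne, h⟩
    rw [isPreirreducible_iff_isClosed_union_isClosed] at this
    push Not at this
    obtain ⟨Y, Z, hY, hZ, hsub, hCY, hCZ⟩ := this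
    have hunion : (C : Set α) = ((C : Set α) ∩ Y) ∪ (C ∩ Z) := by
      rw [← Set.inter_union_distrib_left, Set.inter_eq_left.2 hsub]
    rw [hunion]
    refine union _ _ (C.isClosed.inter hY) (C.isClosed.inter hZ) (ih' _ (C.isClosed.inter hY) ?_)
      (ih' _ (C.isClosed.inter hZ) ?_)
    · exact ⟨Set.inter_subset_left, fun h => hCY (Set.subset_inter_iff.1 h).2⟩
    · exact ⟨Set.inter_subset_left, fun h => hCZ (Set.subset_inter_iff.1 h).2⟩

section KrullDimension

theorem ringKrullDim_le_of_isIntegral {R S : Type*} [CommRing R] [CommRing S] [IsDomain R]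
    [Algebra R S] [Algebra.IsIntegral R S] [FaithfulSMul R S] :
    ringKrullDim R ≤ ringKrullDim S := by
  refine iSup_le fun l => ?_
  obtain ⟨P, -, hP, hPl⟩ := Ideal.exists_ideal_over_prime_of_isIntegral l.head.asIdeal (⊥ : Ideal S)
    (by rw [Ideal.comap_bot_of_injective _ (FaithfulSMul.algebraMap_injective R S)]; exact bot_le)
  have : P.LiesOver l.head.asIdeal := ⟨hPl.symm⟩
  obtain ⟨L, hL, -⟩ := Ideal.exists_ltSeries_of_hasGoingUp l P
  exact hL ▸ le_iSup (fun L : LTSeries (PrimeSpectrum S) => (L.length : WithBot ℕ∞)) L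

theorem natCast_le_ringKrullDim_of_algebraicIndependent {K R : Type*} [Field K] [CommRing R]
    [IsDomain R] [Algebra K R] [Algebra.FiniteType K R] {m : ℕ} {x : Fin m → R}
    (hx : AlgebraicIndependent K x) : (m : WithBot ℕ∞) ≤ ringKrullDim R := by
  obtain ⟨s, g, hg, hfin⟩ := exists_finite_inj_algHom_of_fg K R
  algebraize [g.toRingHom]
  have : IsScalarTower K (MvPolynomial (Fin s) K) R := .of_algHom g
  have : FaithfulSMul (MvPolynomial (Fin s) K) R := (faithfulSMul_iff_algebraMap_injective _ _).2 hg
  have : Algebra.IsIntegral (MvPolynomial (Fin s) K) R :=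
    algebraMap_isIntegral_iff.1 hfin.to_isIntegral
  have htrdeg : (s : Cardinal) = Algebra.trdeg K R := by
    simpa [trdeg_eq_zero (R := MvPolynomial (Fin s) K)] using
      lift_trdeg_add_eq K (MvPolynomial (Fin s) K) R
  have hms : m ≤ s := by simpa [← htrdeg] using hx.lift_cardinalMk_le_trdeg
  calc (m : WithBot ℕ∞) ≤ s := mod_cast hms
    _ = ringKrullDim (MvPolynomial (Fin s) K) := by simp
    _ ≤ ringKrullDim R := ringKrullDim_le_of_isIntegral

end KrullDimension

variable {K : Type*} [Field K]

section Monomials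

variable {n k : ℕ}

/-- The character `x ↦ x^u` of the torus with exponent vector `u`. -/
def character (u : Fin n → ℤ) : Torus n K →* Kˣ where
  toFun x := ∏ i, x i ^ u i
  map_one' := by simp
  map_mul' x y := by simp [mul_zpow, Finset.prod_mul_distrib]

/-- The monomial homomorphism `x ↦ (x^{A 0}, …, x^{A (k-1)})` of tori. -/
def monomialMap (A : Fin k → Fin n → ℤ) : Torus n K →* Torus k K :=
  MonoidHom.pi fun i => character (A i)

/-- The cocharacter `t ↦ (t^{a 0}, …, t^{a (n-1)})` parametrizing a one-dimensional subtorus. -/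
def cocharacter (a : Fin n → ℤ) : Kˣ →* Torus n K :=
  MonoidHom.pi fun i => zpowGroupHom (a i)

variable (x : Torus n K) (u v : Fin n → ℤ)

theorem character_apply : character u x = ∏ i, x i ^ u i := rfl

@[simp] theorem character_zero : character 0 x = 1 := by simp [character_apply]

theorem character_add : character (u + v) x = character u x * character v x := by
  simp [character_apply, zpow_add, Finset.prod_mul_distrib]

@[simp] theorem monomialMap_apply (A : Fin k → Fin n → ℤ) (i : Fin k) :
    monomialMap A x i = character (A i) x := rfl

theorem character_zsmul (c : ℤ) : character (c • u) x = character u x ^ c := by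
  simp [character_apply, Finset.prod_zpow, zpow_mul, mul_comm c]

@[simp] theorem character_single_one (i : Fin n) : character (Pi.single i 1) x = x i := by
  rw [character_apply, Finset.prod_eq_single i] <;> simp +contextual [Pi.single_eq_of_ne]

theorem character_sum {ι : Type*} (s : Finset ι) (f : ι → Fin n → ℤ) :
    character (∑ i ∈ s, f i) x = ∏ i ∈ s, character (f i) x := by
  classical
  induction s using Finset.induction_on with
  | empty => simp
  | insert a s ha ih => rw [Finset.sum_insert ha, Finset.prod_insert ha, character_add, ih]

theorem character_monomialMap (A : Fin k → Fin n → ℤ) (w : Fin k → ℤ) :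
    character w (monomialMap A x) = character (∑ i, w i • A i) x := by
  simp only [character_sum, character_zsmul]
  rfl

theorem character_cocharacter (a : Fin n → ℤ) (t : Kˣ) :
    character u (cocharacter a t) = t ^ (a ⬝ᵥ u) := by
  change ∏ i, (t ^ a i) ^ u i = _
  simp only [dotProduct, ← zpow_mul]
  exact (map_sum (zpowersHom Kˣ t).toAdditiveRight (fun i => a i * u i) Finset.univ).symm

theorem monomialMap_snoc (A : Fin k → Fin n → ℤ) :
    monomialMap (Fin.snoc A u : Fin (k + 1) → Fin n → ℤ) x =
      (Fin.snoc (monomialMap A x) (character u x) : Fin (k + 1) → Kˣ) := by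
  funext i
  refine Fin.lastCases ?_ (fun i => ?_) i <;> simp

theorem character_snoc (t : Kˣ) (w : Fin (n + 1) → ℤ) :
    character w (Fin.snoc x t : Fin (n + 1) → Kˣ) =
      character (Fin.init w) x * t ^ w (Fin.last n) := by
  simp [character_apply, Fin.prod_univ_castSucc, Fin.init]

end Monomials

section Evaluation

variable {n k : ℕ} (x : Torus n K)

theorem eval_eq_sum (P : Laurent n K) :
    eval x P = ∑ v ∈ P.coeff.support, P.coeff v * (character v x : K) :=
  eval_apply x P

@[simp] theorem eval_single (u : Fin n → ℤ) (c : K) :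
    eval x (AddMonoidAlgebra.single u c) = c * (character u x : K) := by
  simp [eval, AddMonoidAlgebra.lift_single, monomialHom, character_apply]

/-- The comorphism of `monomialMap A`: substitution of the monomials with exponents `A i` for the
variables. -/
noncomputable def monomialSubst (A : Fin k → Fin n → ℤ) : Laurent k K →ₐ[K] Laurent n K :=
  AddMonoidAlgebra.mapDomainAlgHom K K (Fintype.linearCombination ℤ A).toAddMonoidHom

@[simp] theorem monomialSubst_single (A : Fin k → Fin n → ℤ) (w : Fin k → ℤ) (c : K) :
    monomialSubst A (AddMonoidAlgebra.single w c) =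
      AddMonoidAlgebra.single (∑ i, w i • A i) c := by
  simp [monomialSubst, Fintype.linearCombination_apply]

theorem eval_monomialSubst (A : Fin k → Fin n → ℤ) (P : Laurent k K) :
    eval x (monomialSubst A P) = eval (monomialMap A x) P := by
  induction P using AddMonoidAlgebra.induction_linear with
  | zero => simp
  | add P Q hP hQ => simp [hP, hQ]
  | single w c => simp [character_monomialMap]

theorem exists_eval_translate (ζ : Torus n K) (P : Laurent n K) :
    ∃ Q : Laurent n K, ∀ x, eval x Q = eval (ζ * x) P := by
  refine ⟨∑ v ∈ P.coeff.support, AddMonoidAlgebra.single v (P.coeff v * (character v ζ : K)),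
    fun x => ?_⟩
  simp [eval_eq_sum _ P, mul_assoc]

theorem exists_eval_eq (φ : Laurent n K →ₐ[K] K) : ∃ x : Torus n K, φ = eval x := by
  let ψ : Multiplicative (Fin n → ℤ) →* Kˣ :=
    ((φ : Laurent n K →* K).comp (AddMonoidAlgebra.of K (Fin n → ℤ))).toHomUnits
  refine ⟨fun i => ψ (Multiplicative.ofAdd (Pi.single i 1)), ?_⟩
  refine AddMonoidAlgebra.algHom_ext (fun v => ?_) (Subsingleton.elim _ _)
  change (ψ (Multiplicative.ofAdd v) : K) = _
  have hv : v = ∑ i, v i • (Pi.single i 1 : Fin n → ℤ) := by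
    funext j
    simp [Finset.sum_apply, Pi.single_apply]
  rw [eval_single, one_mul, Units.val_inj, character_apply]
  conv_lhs => rw [hv]
  simp only [ofAdd_sum, map_prod, ofAdd_zsmul, map_zpow]

end Evaluation

section Topology

variable {n : ℕ}

theorem isClosed_zeroLocus (S : Set (Laurent n K)) :
    IsClosed {x : Torus n K | ∀ P ∈ S, eval x P = 0} :=
  (isClosed_iff _).2 (isAlgebraic_zeroLocus S)

theorem isClosed_zeros (P : Laurent n K) : IsClosed {x : Torus n K | eval x P = 0} := by
  simpa using isClosed_zeroLocus {P}

theorem continuous_mul_left (ζ : Torus n K) : Continuous fun x : Torus n K => ζ * x := by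
  rw [continuous_iff_isClosed]
  intro X hX
  obtain ⟨S, rfl⟩ := (isClosed_iff X).1 hX
  choose Q hQ using exists_eval_translate ζ
  convert isClosed_zeroLocus (Q '' (S : Set (Laurent n K))) using 1
  ext x
  simp [hQ]

/-- The ideal of Laurent polynomials vanishing on `X`. -/
def vanishingIdeal (X : Set (Torus n K)) : Ideal (Laurent n K) where
  carrier := {P | ∀ x ∈ X, eval x P = 0}
  add_mem' hP hQ x hx := by simp [hP x hx, hQ x hx]
  zero_mem' x _ := by simp
  smul_mem' c P hP x hx := by simp [hP x hx]

theorem mem_of_forall_mem_vanishingIdeal {X : Set (Torus n K)} (hX : IsClosed X) {x : Torus n K}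
    (h : ∀ P ∈ vanishingIdeal X, eval x P = 0) : x ∈ X := by
  obtain ⟨S, rfl⟩ := (isClosed_iff X).1 hX
  exact fun P hP => h P fun y hy => hy P hP

theorem vanishingIdeal_isPrime {X : Set (Torus n K)} (hX : IsIrreducible X) :
    (vanishingIdeal X).IsPrime := by
  refine ⟨fun h => ?_, fun {P Q} h => ?_⟩
  · obtain ⟨x, hx⟩ := hX.1
    have hone : (1 : Laurent n K) ∈ vanishingIdeal X := h ▸ Submodule.mem_top
    simpa using hone x hx
  · have hPQ : X ⊆ {x | eval x P = 0} ∪ {x | eval x Q = 0} := fun x hx => by simpa using h x hx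
    exact isPreirreducible_iff_isClosed_union_isClosed.1 hX.2 _ _ (isClosed_zeros P)
      (isClosed_zeros Q) hPQ

theorem isIrreducible_of_vanishingIdeal_isPrime {X : Set (Torus n K)}
    (h : (vanishingIdeal X).IsPrime) : IsIrreducible X := by
  refine ⟨?_, isPreirreducible_iff_isClosed_union_isClosed.2 fun Z W hZ hW hXZW => ?_⟩
  · by_contra hne
    rw [Set.not_nonempty_iff_eq_empty] at hne
    exact h.ne_top ((Ideal.eq_top_iff_one _).2 fun x hx => by simp [hne] at hx)
  · by_contra! hcon
    obtain ⟨x, hx, hxZ⟩ := Set.not_subset.1 hcon.1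
    obtain ⟨y, hy, hyW⟩ := Set.not_subset.1 hcon.2
    obtain ⟨P, hP, hPx⟩ : ∃ P ∈ vanishingIdeal Z, eval x P ≠ 0 := by
      by_contra! hc
      exact hxZ (mem_of_forall_mem_vanishingIdeal hZ hc)
    obtain ⟨Q, hQ, hQy⟩ : ∃ Q ∈ vanishingIdeal W, eval y Q ≠ 0 := by
      by_contra! hc
      exact hyW (mem_of_forall_mem_vanishingIdeal hW hc)
    have hPQ : P * Q ∈ vanishingIdeal X := fun z hz => by
      rcases hXZW hz with hz | hz
      · simp [hP z hz]
      · simp [hQ z hz]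
    rcases h.mem_or_mem hPQ with h | h
    · exact hPx (h x hx)
    · exact hQy (h y hy)

instance noetherianSpace_torus : NoetherianSpace (Torus n K) := by
  have := isNoetherianRing_laurent n K
  refine ((noetherianSpace_TFAE (Torus n K)).out 0 1).2 ?_
  have hanti : StrictAnti fun C : Closeds (Torus n K) => vanishingIdeal (C : Set (Torus n K)) :=
    fun C D hCD => lt_of_le_of_ne (fun P hP x hx => hP x (hCD.le hx)) fun h =>
      hCD.not_ge fun x hx => mem_of_forall_mem_vanishingIdeal C.isClosed fun P hP =>
        (h.ge hP : P ∈ vanishingIdeal _) x hx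
  exact hanti.wellFoundedLT

theorem vanishingIdeal_zeroLocus [IsAlgClosed K] {p : Ideal (Laurent n K)} (hp : p.IsPrime) :
    vanishingIdeal {x : Torus n K | ∀ P ∈ p, eval x P = 0} = p := by
  refine le_antisymm (fun f hf => ?_) fun P hP x hx => hx P hP
  have : IsJacobsonRing (Laurent n K) := isJacobsonRing_of_finiteType (A := K)
  rw [← isJacobsonRing_iff_prime_eq.1 this p hp, Ideal.jacobson, Ideal.mem_sInf]
  rintro M ⟨hpM, hM⟩
  let := Ideal.Quotient.field M
  have : Module.Finite K (Laurent n K ⧸ M) := finite_of_finite_type_of_isJacobsonRing _ _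
  let e : K ≃ₐ[K] (Laurent n K ⧸ M) :=
    AlgEquiv.ofBijective (Algebra.ofId K _) IsAlgClosed.algebraMap_bijective_of_isIntegral
  obtain ⟨x, hx⟩ := exists_eval_eq ((e.symm : (Laurent n K ⧸ M) →ₐ[K] K).comp
    (Ideal.Quotient.mkₐ K M))
  have hxM : ∀ P, eval x P = 0 ↔ P ∈ M := fun P => by
    rw [← hx]
    simp [Ideal.Quotient.eq_zero_iff_mem]
  exact (hxM f).1 (hf x fun P hP => (hxM P).2 (hpM hP))

end Topology

section Dimension

variable {n : ℕ} {X Y : Set (Torus n K)}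

theorem dim_mono (h : Y ⊆ X) : dim Y ≤ dim X :=
  (Topology.IsEmbedding.inclusion h).isInducing.topologicalKrullDim_le

theorem dim_nonneg (hX : X.Nonempty) : 0 ≤ dim X := by
  obtain ⟨x, hx⟩ := hX
  have : Nonempty (IrreducibleCloseds X) :=
    ⟨⟨closure {⟨x, hx⟩}, isIrreducible_singleton.closure, isClosed_closure⟩⟩
  exact Order.krullDim_nonneg

theorem dim_add_one_le (hX : IsIrreducible X) (hY : IsClosed Y) (hYX : Y ⊂ X) :
    dim Y + 1 ≤ dim X := by
  unfold dim topologicalKrullDim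
  rcases isEmpty_or_nonempty (IrreducibleCloseds Y) with h | h
  · simp [Order.krullDim_eq_bot]
  rw [← Order.krullDim_WithTop]
  have := Subtype.irreducibleSpace hX
  let ι : Y → X := Set.inclusion hYX.subset
  have hι : Topology.IsInducing ι := (Topology.IsEmbedding.inclusion hYX.subset).isInducing
  let F : WithTop (IrreducibleCloseds Y) → IrreducibleCloseds X
    | ⊤ => ⟨Set.univ, IrreducibleSpace.isIrreducible_univ X, isClosed_univ⟩
    | (Z : IrreducibleCloseds Y) => IrreducibleCloseds.map ι hι.continuous Z
  have hlt : ∀ Z : IrreducibleCloseds Y, F Z < F ⊤ := fun Z => by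
    refine lt_of_le_of_ne (fun _ _ => trivial) fun h => ?_
    obtain ⟨x, hx, hxY⟩ := Set.exists_of_ssubset hYX
    have hcl : closure (ι '' Z) ⊆ Subtype.val ⁻¹' Y :=
      closure_minimal (by rintro _ ⟨y, _, rfl⟩; exact y.2) (hY.preimage continuous_subtype_val)
    have hxF : (⟨x, hx⟩ : X) ∈ (F Z : Set X) := by rw [h]; trivial
    exact hxY (hcl hxF)
  refine Order.krullDim_le_of_strictMono F fun a b hab => ?_
  induction a using WithTop.recTopCoe with
  | top => exact absurd hab not_top_lt
  | coe a =>
    induction b using WithTop.recTopCoe with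
    | top => exact hlt a
    | coe b => exact IrreducibleCloseds.map_strictMono_of_isInducing hι (WithTop.coe_lt_coe.1 hab)

theorem ringKrullDim_quotient_vanishingIdeal_le_dim [IsAlgClosed K] (hX : IsClosed X) :
    ringKrullDim (Laurent n K ⧸ vanishingIdeal X) ≤ dim X := by
  let I := vanishingIdeal X
  let p (q : PrimeSpectrum (Laurent n K ⧸ I)) : Ideal (Laurent n K) :=
    q.asIdeal.comap (Ideal.Quotient.mk I)
  let Z (q : PrimeSpectrum (Laurent n K ⧸ I)) : Set (Torus n K) := {x | ∀ P ∈ p q, eval x P = 0}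
  have hp (q) : (p q).IsPrime := Ideal.IsPrime.comap _
  have hZp (q) : vanishingIdeal (Z q) = p q := vanishingIdeal_zeroLocus (hp q)
  have hZX (q) : Z q ⊆ X := fun x hx => mem_of_forall_mem_vanishingIdeal hX fun P hP => by
    refine hx P (Ideal.mem_comap.2 ?_)
    rw [Ideal.Quotient.eq_zero_iff_mem.2 hP]
    exact zero_mem _
  have hZ (q) : IsIrreducible ((↑) ⁻¹' Z q : Set X) := by
    have := Subtype.irreducibleSpace (isIrreducible_of_vanishingIdeal_isPrime (hZp q ▸ hp q))
    have himage := (IrreducibleSpace.isIrreducible_univ (Z q)).image (Set.inclusion (hZX q))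
      (continuous_inclusion (hZX q)).continuousOn
    rwa [Set.image_univ, Set.range_inclusion] at himage
  let F (q : (PrimeSpectrum (Laurent n K ⧸ I))ᵒᵈ) : IrreducibleCloseds X :=
    ⟨(↑) ⁻¹' Z q.ofDual, hZ _, (isClosed_zeroLocus _).preimage continuous_subtype_val⟩
  rw [ringKrullDim, ← Order.krullDim_orderDual]
  refine Order.krullDim_le_of_strictMono F fun q r hqr => lt_of_le_not_ge ?_ fun h => ?_
  · exact fun x hx P hP => hx P (Ideal.comap_mono hqr.le hP)
  · have hZZ : Z r.ofDual ⊆ Z q.ofDual := fun x hx => @h ⟨x, hZX _ hx⟩ hx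
    have hle : p q.ofDual ≤ p r.ofDual := by
      rw [← hZp, ← hZp]
      exact fun P hP x hx => hP x (hZZ hx)
    exact hqr.not_ge ((Ideal.comap_le_comap_iff_of_surjective _ Ideal.Quotient.mk_surjective _ _).1
      hle)

end Dimension

section Independence

variable {n m : ℕ}

/-- Algebraic independence, on `X`, of the monomials with exponent vectors `A i`. -/
def Indep (X : Set (Torus n K)) (A : Fin m → Fin n → ℤ) : Prop :=
  ∀ P : Laurent m K, (∀ x ∈ X, eval (monomialMap A x) P = 0) → P = 0

theorem algebraicIndependent_single :
    AlgebraicIndependent K fun i : Fin m =>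
      (AddMonoidAlgebra.single (Pi.single i 1) 1 : Laurent m K) := by
  let ι : (Fin m →₀ ℕ) →+ (Fin m → ℤ) :=
    (Nat.castAddMonoidHom ℤ).compLeft (Fin m) |>.comp Finsupp.coeFnAddHom
  have hι : Function.Injective ι := fun s t h => Finsupp.ext fun i =>
    Int.ofNat_injective (congrFun h i)
  have haeval : (MvPolynomial.aeval fun i : Fin m =>
      (AddMonoidAlgebra.single (Pi.single i 1) 1 : Laurent m K)) =
        AddMonoidAlgebra.mapDomainAlgHom K K ι := by
    refine MvPolynomial.algHom_ext fun i => ?_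
    rw [MvPolynomial.aeval_X, MvPolynomial.X, ← MvPolynomial.single_eq_monomial,
      AddMonoidAlgebra.mapDomainAlgHom_apply, AddMonoidAlgebra.mapDomain_single]
    congr 1
    funext j
    simp [ι, Pi.single_apply, Finsupp.single_apply, eq_comm]
  rw [AlgebraicIndependent, haeval]
  exact AddMonoidAlgebra.mapDomain_injective hι

variable {X : Set (Torus n K)} {A : Fin m → Fin n → ℤ}

theorem Indep.natCast_le_dim [IsAlgClosed K] (hX : IsClosed X) (hirr : IsIrreducible X)
    (hA : Indep X A) : (m : WithBot ℕ∞) ≤ dim X := by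
  have := vanishingIdeal_isPrime hirr
  let φ : Laurent m K →ₐ[K] Laurent n K ⧸ vanishingIdeal X :=
    (Ideal.Quotient.mkₐ K (vanishingIdeal X)).comp (monomialSubst A)
  have hφ : Function.Injective φ := by
    refine (injective_iff_map_eq_zero φ).2 fun P hP => hA P fun x hx => ?_
    rw [← eval_monomialSubst]
    exact Ideal.Quotient.eq_zero_iff_mem.1 hP x hx
  exact (natCast_le_ringKrullDim_of_algebraicIndependent
    (algebraicIndependent_single.map' hφ)).trans (ringKrullDim_quotient_vanishingIdeal_le_dim hX)

theorem indep_of_nonempty (hX : X.Nonempty) (A : Fin 0 → Fin n → ℤ) : Indep X A := by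
  intro P hP
  obtain ⟨x, hx⟩ := hX
  obtain ⟨c, rfl⟩ : ∃ c, P = AddMonoidAlgebra.single 0 c := by
    refine ⟨P.coeff 0, AddMonoidAlgebra.coeff_injective (Finsupp.ext fun v => ?_)⟩
    rw [Subsingleton.elim v 0]
    simp
  simpa using hP x hx

theorem exists_maximal_indep [IsAlgClosed K] (hX : IsClosed X) (hirr : IsIrreducible X) {d : ℕ}
    (hd : dim X ≤ d) (hA : Indep X A) :
    ∃ (k : ℕ) (h : m ≤ k) (D : Fin k → Fin n → ℤ), k ≤ d ∧ (∀ i, D (Fin.castLE h i) = A i) ∧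
      Indep X D ∧ ∀ u, ¬ Indep X (Fin.snoc D u : Fin (k + 1) → Fin n → ℤ) := by
  have hle {k : ℕ} {D : Fin k → Fin n → ℤ} (hD : Indep X D) : k ≤ d :=
    mod_cast (hD.natCast_le_dim hX hirr).trans hd
  induction hk : d - m using Nat.strong_induction_on generalizing m with
  | h _ ih =>
    by_cases! hu : ∃ u, Indep X (Fin.snoc A u : Fin (m + 1) → Fin n → ℤ)
    · obtain ⟨u, hu⟩ := hu
      obtain ⟨k, h, D, hkd, hDA, hD, hmax⟩ := ih _ (by have := hle hu; omega) hu rfl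
      refine ⟨k, (Nat.le_succ m).trans h, D, hkd, fun i => ?_, hD, hmax⟩
      rw [← Fin.snoc_castSucc (α := fun _ => Fin n → ℤ) u A i, ← hDA]
      rfl
    · exact ⟨m, le_rfl, A, hle hA, fun _ => rfl, hA, hu⟩

end Independence

section Zeros

theorem hasCardLE_zeros_sum_pow {ι : Type*} (s : Finset ι) (c : ι → K) (e : ι → ℕ) {M : ℕ}
    (hM : ∀ i ∈ s, e i ≤ M) {ε : ℕ} (hε : ∑ i ∈ s with e i = ε, c i ≠ 0) :
    HasCardLE {t : K | ∑ i ∈ s, c i * t ^ e i = 0} M := by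
  classical
  let p : Polynomial K := ∑ i ∈ s, Polynomial.monomial (e i) (c i)
  have hp : p ≠ 0 := fun h => hε <| by
    simpa [p, Polynomial.finsetSum_coeff, Polynomial.coeff_monomial, Finset.sum_filter] using
      congrArg (Polynomial.coeff · ε) h
  have hdeg : p.natDegree ≤ M := Polynomial.natDegree_sum_le_of_forall_le _ _ fun i hi =>
    (Polynomial.natDegree_monomial_le _).trans (hM i hi)
  refine (HasCardLE.coe_finset p.roots.toFinset).mono (fun t ht => ?_) ?_
  · simpa [hp, p, Polynomial.eval_finsetSum] using ht
  · exact_mod_cast (Multiset.toFinset_card_le _).trans (p.card_roots'.trans hdeg)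

theorem hasCardLE_zeros_sum_zpow {ι : Type*} (s : Finset ι) (c : ι → K) (e : ι → ℤ) {M : ℕ}
    (hM : ∀ i ∈ s, |e i| ≤ M) {ε : ℤ} (hε : ∑ i ∈ s with e i = ε, c i ≠ 0) :
    HasCardLE {t : Kˣ | ∑ i ∈ s, c i * ((t ^ e i : Kˣ) : K) = 0} (2 * M) := by
  have hnonneg : ∀ i ∈ s, 0 ≤ e i + M := fun i hi => by linarith [neg_abs_le (e i), hM i hi]
  have hε' : ∑ i ∈ s with (e i + M).toNat = (ε + M).toNat, c i ≠ 0 := by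
    obtain ⟨i, hi, -⟩ := Finset.exists_ne_zero_of_sum_ne_zero hε
    obtain ⟨his, rfl⟩ := Finset.mem_filter.1 hi
    rwa [Finset.filter_congr (q := fun j => e j = e i) fun j hj => by
      have := hnonneg i his; have := hnonneg j hj; omega]
  have hcard := hasCardLE_zeros_sum_pow s c (fun i => (e i + M).toNat) (M := 2 * M)
    (fun i hi => by have := abs_le.1 (hM i hi); omega) hε'
  rw [Nat.cast_mul, Nat.cast_two] at hcard
  refine hcard.of_injOn (f := Units.val) (fun t ht => ?_) Units.val_injective.injOn
  calc ∑ i ∈ s, c i * (t : K) ^ (e i + M).toNat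
      = (t : K) ^ M * ∑ i ∈ s, c i * ((t ^ e i : Kˣ) : K) := by
        rw [Finset.mul_sum]
        refine Finset.sum_congr rfl fun i hi => ?_
        rw [← Units.val_pow_eq_pow_val, ← zpow_natCast, Int.toNat_of_nonneg (hnonneg i hi),
          zpow_add, zpow_natCast]
        push_cast
        ring
    _ = 0 := mul_eq_zero_of_right _ ht

variable {m : ℕ}

/-- The coefficient of `t ^ ε` in `f(z, t)`, a Laurent polynomial in `z`. -/
noncomputable def lastCoeff (f : Laurent (m + 1) K) (ε : ℤ) : Laurent m K :=
  ∑ v ∈ f.coeff.support with v (Fin.last m) = ε, AddMonoidAlgebra.single (Fin.init v) (f.coeff v)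

theorem exists_lastCoeff_ne_zero {f : Laurent (m + 1) K} (hf : f ≠ 0) :
    ∃ ε, lastCoeff f ε ≠ 0 := by
  obtain ⟨v, hv⟩ : f.coeff.support.Nonempty := Finsupp.support_nonempty_iff.2 (by simpa using hf)
  refine ⟨v (Fin.last m), fun h => Finsupp.mem_support_iff.1 hv ?_⟩
  have hcoeff := congrArg (fun P : Laurent m K => P.coeff (Fin.init v)) h
  simp only [lastCoeff, AddMonoidAlgebra.coeff_sum, AddMonoidAlgebra.coeff_single,
    Finsupp.finsetSum_apply, Finsupp.single_apply] at hcoeff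
  rw [Finset.sum_eq_single_of_mem v (by simpa using hv)] at hcoeff
  · simpa using hcoeff
  · intro w hw hwv
    refine if_neg fun h => hwv ?_
    rw [← Fin.snoc_init_self w, ← Fin.snoc_init_self v, h, (Finset.mem_filter.1 hw).2]

theorem exists_hasCardLE_zeros_snoc {f : Laurent (m + 1) K} (hf : f ≠ 0) :
    ∃ P : Laurent m K, P ≠ 0 ∧ ∃ M : ℕ, ∀ z, eval z P ≠ 0 →
      HasCardLE {t : Kˣ | eval (Fin.snoc z t : Torus (m + 1) K) f = 0} M := by
  obtain ⟨ε, hε⟩ := exists_lastCoeff_ne_zero hf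
  let M := f.coeff.support.sup fun v => (v (Fin.last m)).natAbs
  have hM : ∀ v ∈ f.coeff.support, |v (Fin.last m)| ≤ M := fun v hv => by
    rw [Int.abs_eq_natAbs]
    exact_mod_cast Finset.le_sup (f := fun v : Fin (m + 1) → ℤ => (v (Fin.last m)).natAbs) hv
  refine ⟨lastCoeff f ε, hε, 2 * M, fun z hz => ?_⟩
  have hcard := hasCardLE_zeros_sum_zpow f.coeff.support
    (fun v => f.coeff v * (character (Fin.init v) z : K)) (fun v => v (Fin.last m)) hM (ε := ε)
    (by simpa [lastCoeff] using hz)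
  rw [Nat.cast_mul, Nat.cast_two]
  refine hcard.mono (fun t ht => ?_) le_rfl
  rw [Set.mem_ofPred_eq, eval_eq_sum] at ht
  simpa [character_snoc, mul_assoc] using ht

end Zeros

section Fibers

variable {n m : ℕ} {X : Set (Torus n K)} {B : Fin m → Fin n → ℤ}

theorem exists_hasCardLE_fiber (hX : IsClosed X) (hB : Indep X B)
    (hmax : ∀ u, ¬ Indep X (Fin.snoc B u : Fin (m + 1) → Fin n → ℤ)) :
    ∃ (C : ℕ) (Y : Set (Torus n K)), IsClosed Y ∧ Y ⊂ X ∧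
      ∀ z, HasCardLE {x ∈ X \ Y | monomialMap B x = z} C := by
  simp only [Indep, not_forall] at hmax
  choose f hfX hf using fun j : Fin n => hmax (Pi.single j 1)
  choose P hP M hM using fun j => exists_hasCardLE_zeros_snoc (hf j)
  let Q : Laurent n K := monomialSubst B (∏ j, P j)
  have hQ : Q ∉ vanishingIdeal X := fun h => by
    refine (Finset.prod_ne_zero_iff.2 fun j _ => hP j : ∏ j, P j ≠ 0) (hB _ fun x hx => ?_)
    rw [← eval_monomialSubst]
    exact h x hx
  refine ⟨∏ j, M j, X ∩ {x | eval x Q = 0}, hX.inter (isClosed_zeros Q),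
    ⟨Set.inter_subset_left, fun h => hQ fun x hx => (h hx).2⟩, fun z => ?_⟩
  by_cases hz : ∀ j, eval z (P j) ≠ 0
  · rw [Nat.cast_prod]
    refine (HasCardLE.pi fun j => hM j z (hz j)).mono ?_ le_rfl
    rintro x ⟨⟨hx, -⟩, rfl⟩ j
    have := hfX j x hx
    rwa [monomialMap_snoc, character_single_one] at this
  · refine (HasCardLE.empty (Nat.cast_nonneg _)).mono ?_ le_rfl
    rintro x ⟨⟨hx, hxY⟩, rfl⟩
    push Not at hz
    obtain ⟨j, hj⟩ := hz
    refine hxY ⟨hx, ?_⟩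
    change eval x Q = 0
    rw [eval_monomialSubst, map_prod]
    exact Finset.prod_eq_zero (Finset.mem_univ j) hj

end Fibers

section TorsionGrowth

theorem hasCardLE_pow_eq_one {N : ℕ} (hN : 0 < N) : HasCardLE {t : Kˣ | t ^ N = 1} N := by
  have : NeZero N := ⟨hN.ne'⟩
  have hset : {t : Kˣ | t ^ N = 1} = (rootsOfUnity N K : Set Kˣ) := by
    ext t
    simp
  rw [hset]
  exact ⟨inferInstanceAs (Finite (rootsOfUnity N K)),
    mod_cast (Nat.card_coe_set_eq _).symm.trans_le (card_rootsOfUnity K N)⟩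

theorem hasCardLE_pow_eq_one_of_castLE_eq {m p : ℕ} (hpm : p ≤ m) (y : Torus p K) {N : ℕ}
    (hN : 0 < N) :
    HasCardLE {z : Torus m K | z ^ N = 1 ∧ ∀ i, z (Fin.castLE hpm i) = y i}
      ((N : ℝ) ^ (m - p)) := by
  obtain ⟨q, rfl⟩ := Nat.exists_eq_add_of_le hpm
  have hcard := HasCardLE.pi fun _ : Fin q => hasCardLE_pow_eq_one (K := K) hN
  rw [Finset.prod_const, Finset.card_univ, Fintype.card_fin] at hcard
  rw [Nat.add_sub_cancel_left]
  refine hcard.of_injOn (f := fun z j => z (Fin.natAdd p j))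
    (fun z hz j => congrFun hz.1 _) fun z hz w hw h => ?_
  funext i
  refine Fin.addCases (fun i => ?_) (fun j => congrFun h j) i
  exact (hz.2 i).trans (hw.2 i).symm

variable {n : ℕ} {X Y : Set (Torus n K)}

theorem exists_hasCardLE_pow_eq_one [IsAlgClosed K] (hX : IsClosed X) {e : ℕ} (hd : dim X ≤ e) :
    ∃ C : ℝ, ∀ N : ℕ, 0 < N → HasCardLE {x ∈ X | x ^ N = 1} (C * N ^ e) := by
  revert hd
  refine closed_induction (P := fun X => dim X ≤ e →
    ∃ C : ℝ, ∀ N : ℕ, 0 < N → HasCardLE {x ∈ X | x ^ N = 1} (C * N ^ e))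
    (fun _ => ⟨0, fun N _ => ?_⟩) (fun Y Z _ _ hY hZ hd => ?_)
    (fun Z hZ hirr ih hd => ?_) hX
  · exact (HasCardLE.empty (by simp)).mono (fun x hx => hx.1) le_rfl
  · obtain ⟨C, hC⟩ := hY ((dim_mono Set.subset_union_left).trans hd)
    obtain ⟨C', hC'⟩ := hZ ((dim_mono Set.subset_union_right).trans hd)
    refine ⟨C + C', fun N hN => ((hC N hN).union (hC' N hN)).mono ?_ (add_mul _ _ _).ge⟩
    rintro x ⟨hx | hx, hxN⟩
    exacts [.inl ⟨hx, hxN⟩, .inr ⟨hx, hxN⟩]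
  · obtain ⟨m, -, D, hme, -, hD, hmax⟩ :=
      exists_maximal_indep hZ hirr hd (indep_of_nonempty hirr.1 Fin.elim0)
    obtain ⟨C, Y, hY, hYZ, hC⟩ := exists_hasCardLE_fiber hZ hD hmax
    obtain ⟨C', hC'⟩ := ih Y hY hYZ ((dim_mono hYZ.subset).trans hd)
    refine ⟨C + C', fun N hN => ?_⟩
    have hout : HasCardLE {x ∈ Z \ Y | x ^ N = 1} ((N : ℝ) ^ (m - 0) * C) := by
      refine (hasCardLE_pow_eq_one_of_castLE_eq m.zero_le 1 hN).of_fibers (monomialMap D)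
        (fun x hx => ⟨?_, fun i => i.elim0⟩) (Nat.cast_nonneg _) fun z _ => ?_
      · rw [← map_pow, hx.2, map_one]
      · exact (hC z).mono (fun x hx => ⟨hx.1.1, hx.2⟩) le_rfl
    refine (hout.union (hC' N hN)).mono (fun x hx => ?_) ?_
    · by_cases hxY : x ∈ Y
      exacts [.inr ⟨hxY, hx.2⟩, .inl ⟨⟨hx.1, hxY⟩, hx.2⟩]
    · rw [add_mul, mul_comm (C : ℝ)]
      gcongr
      · exact_mod_cast hN
      · omega

/-- The number of torsion points of `X` of order at most `T` is `O(T ^ e)`, uniformly in `T ≥ 1`. -/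
def HasTorsionGrowth (X : Set (Torus n K)) (e : ℝ) : Prop :=
  ∃ c : ℝ, ∀ T : ℝ, 1 ≤ T → HasCardLE (torsionUpTo X T) (c * T ^ e)

namespace HasTorsionGrowth

variable {e e' : ℝ}

theorem mono (h : HasTorsionGrowth X e) (hYX : Y ⊆ X) (he : e ≤ e') : HasTorsionGrowth Y e' := by
  obtain ⟨c, hc⟩ := h
  refine ⟨c, fun T hT => (hc T hT).mono (fun x hx => ⟨hYX hx.1, hx.2⟩) ?_⟩
  have hc0 : 0 ≤ c := by simpa using (hc 1 le_rfl).nonneg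
  gcongr

theorem union (hX : HasTorsionGrowth X e) (hY : HasTorsionGrowth Y e) :
    HasTorsionGrowth (X ∪ Y) e := by
  obtain ⟨c, hc⟩ := hX
  obtain ⟨c', hc'⟩ := hY
  refine ⟨c + c', fun T hT => ((hc T hT).union (hc' T hT)).mono ?_ (add_mul _ _ _).ge⟩
  rintro x ⟨hx | hx, hxT⟩
  exacts [.inl ⟨hx, hxT⟩, .inr ⟨hx, hxT⟩]

theorem of_finite (hX : X.Finite) (he : 0 ≤ e) : HasTorsionGrowth X e := by
  refine ⟨X.ncard, fun T hT => HasCardLE.mono ⟨hX, le_rfl⟩ (fun x hx => hx.1) ?_⟩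
  exact le_mul_of_one_le_right (Nat.cast_nonneg _) (Real.one_le_rpow hT he)

theorem of_forall_orderOf {C s : ℝ} (hs : 0 ≤ s)
    (h : ∀ N : ℕ, 0 < N → HasCardLE {x ∈ X | orderOf x = N} (C * (N : ℝ) ^ s)) :
    HasTorsionGrowth X (s + 1) := by
  have hC : 0 ≤ C := by simpa using (h 1 one_pos).nonneg
  refine ⟨C, fun T hT => ?_⟩
  have hT0 : 0 ≤ T := zero_le_one.trans hT
  refine (HasCardLE.biUnion (s := Finset.Icc 1 ⌊T⌋₊) fun N hN => h N (Finset.mem_Icc.1 hN).1).mono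
    (fun x ⟨hx, hfin, hxT⟩ => ?_) ?_
  · exact Set.mem_biUnion (Finset.mem_Icc.2 ⟨hfin.orderOf_pos, Nat.le_floor hxT⟩) ⟨hx, rfl⟩
  · calc ∑ N ∈ Finset.Icc 1 ⌊T⌋₊, C * (N : ℝ) ^ s
        ≤ ∑ _N ∈ Finset.Icc 1 ⌊T⌋₊, C * T ^ s := by
          refine Finset.sum_le_sum fun N hN => ?_
          gcongr
          exact (Nat.cast_le.2 (Finset.mem_Icc.1 hN).2).trans (Nat.floor_le hT0)
      _ = ⌊T⌋₊ * (C * T ^ s) := by simp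
      _ ≤ T * (C * T ^ s) := by gcongr; exact Nat.floor_le hT0
      _ = C * T ^ (s + 1) := by rw [Real.rpow_add_one (zero_lt_one.trans_le hT).ne']; ring

end HasTorsionGrowth

theorem hasTorsionGrowth_of_dim_lt [IsAlgClosed K] (hX : IsClosed X) {d : ℕ} (hd : dim X < d) :
    HasTorsionGrowth X d := by
  cases d with
  | zero =>
    obtain rfl : X = ∅ :=
      Set.not_nonempty_iff_eq_empty.1 fun h => (dim_nonneg h).not_gt (by simpa using hd)
    exact .of_finite Set.finite_empty (by simp)
  | succ e =>
    obtain ⟨C, hC⟩ := exists_hasCardLE_pow_eq_one hX (ENat.WithBot.lt_add_one_iff.1 (mod_cast hd))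
    rw [Nat.cast_succ]
    refine .of_forall_orderOf e.cast_nonneg (C := C) fun N hN => ?_
    rw [Real.rpow_natCast]
    refine (hC N hN).mono ?_ le_rfl
    rintro x ⟨hx, rfl⟩
    exact ⟨hx, pow_orderOf_eq_one x⟩

end TorsionGrowth

section OneParameterSubgroups

variable {k : ℕ}

theorem exists_cocharacter_eq {η : Torus k K} (hη : IsOfFinOrder η) :
    ∃ (ω : Kˣ) (b : Fin k → ℤ), ω ^ orderOf η = 1 ∧ cocharacter b ω = η := by
  have : NeZero (orderOf η) := ⟨hη.orderOf_pos.ne'⟩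
  obtain ⟨ω, hω⟩ := IsCyclic.exists_zpow_surjective (G := rootsOfUnity (orderOf η) K)
  choose b hb using fun i => hω ⟨η i, (mem_rootsOfUnity _ _).2 (congrFun (pow_orderOf_eq_one η) i)⟩
  exact ⟨ω, b, (mem_rootsOfUnity _ _).1 ω.2, funext fun i => congrArg Subtype.val (hb i)⟩

theorem exists_mul_sub_dvd_of_pow_lt {N q : ℕ} (hq : 0 < q) (hqN : q ^ k < N) (b : Fin k → ℤ) :
    ∃ (j : ℕ) (a : Fin k → ℤ), 0 < j ∧ j < N ∧ (∀ i, (N : ℤ) ∣ a i - j * b i) ∧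
      ∀ i, q * |a i| < N := by
  have hN : (0 : ℤ) < N := mod_cast (Nat.zero_le _).trans_lt hqN
  let box (j : ℕ) (i : Fin k) : ℤ := q * (j * b i % N) / N
  have hbox : ∀ j ∈ Finset.range N, box j ∈ Fintype.piFinset fun _ => Finset.Ico 0 (q : ℤ) := by
    intro j _
    rw [Fintype.mem_piFinset]
    intro i
    have hnonneg : 0 ≤ j * b i % N := Int.emod_nonneg _ hN.ne'
    have hlt : j * b i % N < N := Int.emod_lt_of_pos _ hN
    refine Finset.mem_Ico.2 ⟨by positivity, Int.ediv_lt_of_lt_mul hN ?_⟩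
    exact mul_lt_mul_of_pos_left hlt (Int.natCast_pos.2 hq)
  obtain ⟨j, hj, j', hj', hne, hbox_eq⟩ :=
    Finset.exists_ne_map_eq_of_card_lt_of_maps_to (by simpa using hqN) hbox
  wlog hlt : j < j' generalizing j j'
  · exact this j' hj' j hj hne.symm hbox_eq.symm (by omega)
  rw [Finset.mem_range] at hj hj'
  refine ⟨j' - j, fun i => j' * b i % N - j * b i % N, by omega, by omega, fun i => ?_, fun i => ?_⟩
  · rw [Nat.cast_sub hlt.le, ← Int.modEq_iff_dvd, sub_mul]
    exact (Int.mod_modEq _ _).symm.sub (Int.mod_modEq _ _).symm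
  · have hquot := congrFun hbox_eq i
    have hr := Int.mul_ediv_add_emod (q * (j * b i % N)) N
    have hr' := Int.mul_ediv_add_emod (q * (j' * b i % N)) N
    rw [show q * (j * b i % N) / (N : ℤ) = _ from hquot] at hr
    rw [← Nat.abs_cast q, ← abs_mul, mul_sub, abs_lt]
    constructor <;>
    linarith [Int.emod_nonneg (q * (j * b i % N)) hN.ne', Int.emod_lt_of_pos (q * (j * b i % N)) hN,
      Int.emod_nonneg (q * (j' * b i % N)) hN.ne', Int.emod_lt_of_pos (q * (j' * b i % N)) hN]

/-- Dirichlet's theorem on simultaneous approximation of the fractions `b i / N`. -/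
theorem exists_mul_sub_dvd_of_two_le (hk : k ≠ 0) {N : ℕ} (hN : 2 ≤ N) (b : Fin k → ℤ) :
    ∃ (j : ℕ) (a : Fin k → ℤ), 0 < j ∧ j < N ∧ (∀ i, (N : ℤ) ∣ a i - j * b i) ∧
      ∀ i, |(a i : ℝ)| ≤ 2 * (N : ℝ) ^ (1 - 1 / (k : ℝ)) := by
  have hN0 : (0 : ℝ) < N := by positivity
  set r : ℝ := (N : ℝ) ^ (1 / (k : ℝ)) with hr
  have hr1 : 1 < r := Real.one_lt_rpow (by exact_mod_cast hN) (by positivity)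
  obtain ⟨q, hq⟩ : ∃ q, ⌈r⌉₊ = q + 1 :=
    Nat.exists_eq_succ_of_ne_zero (Nat.ceil_pos.2 (zero_lt_one.trans hr1)).ne'
  have hqr : q < r := Nat.lt_ceil.1 (hq ▸ q.lt_succ_self)
  have hrq : r ≤ q + 1 := by exact_mod_cast hq ▸ Nat.le_ceil r
  have hq1 : (1 : ℝ) ≤ q := by
    have : 0 < (q : ℝ) := by linarith
    exact_mod_cast this
  have hqN : q ^ k < N := by
    have : (q : ℝ) ^ k < r ^ k := pow_lt_pow_left₀ hqr q.cast_nonneg hk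
    rw [hr, one_div, Real.rpow_inv_natCast_pow hN0.le hk] at this
    exact_mod_cast this
  obtain ⟨j, a, hj, hjN, hdvd, ha⟩ := exists_mul_sub_dvd_of_pow_lt (Nat.one_le_cast.1 hq1) hqN b
  refine ⟨j, a, hj, hjN, hdvd, fun i => ?_⟩
  have hai : (q : ℝ) * |(a i : ℝ)| < N := by exact_mod_cast ha i
  rw [Real.rpow_sub hN0, Real.rpow_one, ← mul_div_assoc, le_div_iff₀ (by positivity)]
  calc |(a i : ℝ)| * r ≤ |(a i : ℝ)| * (2 * q) := by gcongr; linarith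
    _ ≤ 2 * N := by linarith

theorem exists_eq_smul_primitive {a : Fin k → ℤ} (ha : a ≠ 0) :
    ∃ (h : ℤ) (c v : Fin k → ℤ), h ≠ 0 ∧ a = h • c ∧ c ⬝ᵥ v = 1 := by
  obtain ⟨h, hspan⟩ := (IsPrincipalIdealRing.principal (Ideal.span (Set.range a))).principal
  have hmem : h ∈ Ideal.span (Set.range a) := hspan ▸ Submodule.mem_span_singleton_self h
  obtain ⟨v, hv⟩ := Ideal.mem_span_range_iff_exists_fun.1 hmem
  have hdvd (i : Fin k) : h ∣ a i :=
    Ideal.mem_span_singleton.1 (hspan.le (Ideal.subset_span (Set.mem_range_self i)))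
  choose c hc using hdvd
  have hac : a = h • c := funext hc
  have hh : h ≠ 0 := by
    rintro rfl
    exact ha (by simpa using hac)
  refine ⟨h, c, v, hh, hac, mul_left_cancel₀ hh ?_⟩
  calc h * (c ⬝ᵥ v) = a ⬝ᵥ v := by rw [hac, smul_dotProduct, smul_eq_mul]
    _ = h * 1 := by rw [mul_one, dotProduct_comm]; exact hv

theorem cocharacter_smul (h : ℤ) (c : Fin k → ℤ) (t : Kˣ) :
    cocharacter (h • c) t = cocharacter c (t ^ h) :=
  funext fun i => zpow_mul t h (c i)

theorem exists_small_cocharacter_eq_pow (hk : k ≠ 0) {η : Torus k K} (hη : IsOfFinOrder η)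
    (hη1 : η ≠ 1) :
    ∃ (j : ℕ) (a : Fin k → ℤ) (ω : Kˣ), a ≠ 0 ∧ cocharacter a ω = η ^ j ∧
      (∀ i, ((j.gcd (orderOf η) : ℕ) : ℤ) ∣ a i) ∧ 0 < j ∧
      ∀ i, |(a i : ℝ)| ≤ 2 * (orderOf η : ℝ) ^ (1 - 1 / (k : ℝ)) := by
  have hN : 2 ≤ orderOf η := by
    have := hη.orderOf_pos
    have := orderOf_eq_one_iff.not.2 hη1
    omega
  obtain ⟨ω, b, hω, hb⟩ := exists_cocharacter_eq hη
  obtain ⟨j, a, hj, hjN, hdvd, ha⟩ := exists_mul_sub_dvd_of_two_le hk hN b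
  have hpow : cocharacter a ω = η ^ j := by
    rw [← hb]
    funext i
    obtain ⟨c, hc⟩ := hdvd i
    change ω ^ a i = (ω ^ b i) ^ j
    rw [show a i = b i * j + orderOf η * c by linear_combination hc, zpow_add, zpow_mul, zpow_mul,
      zpow_natCast ω, hω, one_zpow, mul_one, zpow_natCast]
  refine ⟨j, a, ω, ?_, hpow, fun i => ?_, hj, ha⟩
  · rintro rfl
    refine pow_ne_one_of_lt_orderOf hj.ne' hjN (hpow ▸ ?_)
    exact funext fun _ => zpow_zero ω
  · refine (dvd_sub_left (Dvd.dvd.mul_right ?_ _)).1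
      ((Int.natCast_dvd_natCast.2 (Nat.gcd_dvd_right j _)).trans (hdvd i))
    exact Int.natCast_dvd_natCast.2 (Nat.gcd_dvd_left j _)

theorem exists_pow_mem_range_cocharacter (hk : k ≠ 0) {η : Torus k K} (hη : IsOfFinOrder η) :
    ∃ (g : ℕ) (a : Fin k → ℤ), 0 < g ∧ (∃ v, a ⬝ᵥ v = 1) ∧
      (∀ i, (g : ℝ) * |(a i : ℝ)| ≤ 2 * (orderOf η : ℝ) ^ (1 - 1 / (k : ℝ))) ∧
      η ^ g ∈ (cocharacter (K := K) a).range := by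
  rcases eq_or_ne η 1 with rfl | hη1
  · let i₀ : Fin k := ⟨0, Nat.pos_of_ne_zero hk⟩
    refine ⟨1, Pi.single i₀ 1, one_pos, ⟨Pi.single i₀ 1, by simp⟩, fun i => ?_, by simp⟩
    rcases eq_or_ne i i₀ with rfl | hi
    · simp
    · simp [Pi.single_eq_of_ne hi]
  obtain ⟨j, a, ω, ha0, hpow, hdvd, hj, ha⟩ := exists_small_cocharacter_eq_pow hk hη hη1
  obtain ⟨h, c, v, hh, rfl, hcv⟩ := exists_eq_smul_primitive ha0
  have hgh : ((j.gcd (orderOf η) : ℕ) : ℤ) ∣ h := by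
    have hsum : (h • c) ⬝ᵥ v = h := by rw [smul_dotProduct, hcv, smul_eq_mul, mul_one]
    exact hsum ▸ Finset.dvd_sum fun i _ => (hdvd i).mul_right (v i)
  have hle : ((j.gcd (orderOf η) : ℕ) : ℤ) ≤ |h| :=
    Int.le_of_dvd (abs_pos.2 hh) ((dvd_abs _ _).2 hgh)
  refine ⟨j.gcd (orderOf η), c, Nat.gcd_pos_of_pos_left _ hj, ⟨v, hcv⟩, fun i => ?_, ?_⟩
  · refine le_trans ?_ (ha i)
    rw [Pi.smul_apply, smul_eq_mul, Int.cast_mul, abs_mul]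
    gcongr
    exact_mod_cast hle
  · rw [← zpow_natCast, Nat.gcd_eq_gcd_ab, zpow_add, zpow_mul, zpow_mul, zpow_natCast, zpow_natCast,
      pow_orderOf_eq_one, one_zpow, mul_one, ← hpow, cocharacter_smul]
    exact zpow_mem (MonoidHom.mem_range.2 ⟨_, rfl⟩) _

theorem hasCardLE_pow_eq_one_and_character_eq_one {g : ℕ} (hg : 0 < g) {a v : Fin k → ℤ}
    (hav : a ⬝ᵥ v = 1) :
    HasCardLE {ξ : Torus k K | ξ ^ g = 1 ∧ character v ξ = 1} ((g : ℝ) ^ (k - 1)) := by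
  have hk : k ≠ 0 := by
    rintro rfl
    simp at hav
  obtain ⟨hfin, hμg⟩ := hasCardLE_pow_eq_one (K := K) hg
  let S : Set (Torus k K) := {ξ | ξ ^ g = 1 ∧ character v ξ = 1}
  let μ : Set Kˣ := {t | t ^ g = 1}
  have : Finite μ := hfin
  have : Nonempty μ := ⟨⟨1, one_pow g⟩⟩
  let ψ (p : S × μ) : Torus k K := p.1.1 * cocharacter a p.2.1
  have hψ (p : S × μ) : ψ p ^ g = 1 := by
    rw [mul_pow, p.1.2.1, ← map_pow, p.2.2, map_one, one_mul]
  let φ (p : S × μ) (i : Fin k) : μ := ⟨ψ p i, congrFun (hψ p) i⟩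
  have hφ : Function.Injective φ := fun p p' h => by
    have heq : p.1.1 * cocharacter a p.2.1 = p'.1.1 * cocharacter a p'.2.1 :=
      funext fun i => congrArg Subtype.val (congrFun h i)
    have hchar := congrArg (character v) heq
    simp only [map_mul, character_cocharacter, hav, zpow_one, p.1.2.2, p'.1.2.2, one_mul] at hchar
    rw [hchar, mul_left_inj] at heq
    exact Prod.ext (Subtype.ext heq) (Subtype.ext hchar)
  have hS : Finite S := .of_injective (fun ξ => φ (ξ, Classical.arbitrary μ)) fun ξ ξ' h =>
    (Prod.ext_iff.1 (hφ h)).1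
  have hcard : Nat.card S * Nat.card μ ≤ Nat.card μ ^ (k - 1) * Nat.card μ := by
    rw [← pow_succ, Nat.sub_add_cancel (Nat.one_le_iff_ne_zero.2 hk), ← Nat.card_prod]
    simpa only [Nat.card_fun, Nat.card_fin] using Nat.card_le_card_of_injective φ hφ
  refine ⟨hS, ?_⟩
  calc (S.ncard : ℝ) ≤ (Nat.card μ : ℝ) ^ (k - 1) :=
        mod_cast Nat.le_of_mul_le_mul_right hcard Nat.card_pos
    _ ≤ (g : ℝ) ^ (k - 1) := by gcongr; exact_mod_cast hμg

end OneParameterSubgroups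

section ProperZeros

variable {k : ℕ}

/-- The zeros of `f` at which no proper partial sum of the terms of `f` vanishes. A coset of a
one-parameter subgroup through such a zero is not contained in the zero set of `f` when
`HasFullSupport f`. -/
def properZeros (f : Laurent k K) : Set (Torus k K) :=
  {η | eval η f = 0 ∧ ∀ s ⊂ f.coeff.support, s.Nonempty →
    ∑ v ∈ s, f.coeff v * (character v η : K) ≠ 0}

/-- The Newton polytope of `f` is full-dimensional: no nonzero linear form is constant on the
exponents of `f`. -/
def HasFullSupport (f : Laurent k K) : Prop :=
  ∀ a : Fin k → ℤ, a ≠ 0 → ∃ v ∈ f.coeff.support, ∃ w ∈ f.coeff.support, a ⬝ᵥ v ≠ a ⬝ᵥ w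

theorem hasCardLE_mul_cocharacter_mem_properZeros {f : Laurent k K} (hf : HasFullSupport f)
    (ξ : Torus k K) {a : Fin k → ℤ} (ha : a ≠ 0) {M : ℕ}
    (hM : ∀ u ∈ f.coeff.support, |a ⬝ᵥ u| ≤ M) :
    HasCardLE {t : Kˣ | ξ * cocharacter a t ∈ properZeros f} (2 * M) := by
  have hchar (u : Fin k → ℤ) (t : Kˣ) :
      f.coeff u * (character u (ξ * cocharacter a t) : K) =
        f.coeff u * (character u ξ : K) * ((t ^ (a ⬝ᵥ u) : Kˣ) : K) := by
    rw [map_mul, character_cocharacter, Units.val_mul, mul_assoc]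
  rcases Set.eq_empty_or_nonempty {t : Kˣ | ξ * cocharacter a t ∈ properZeros f} with
    hempty | ⟨t₀, ht₀⟩
  · exact hempty ▸ .empty (by positivity)
  obtain ⟨u₀, hu₀, w₀, hw₀, hne⟩ := hf a ha
  have hsum : ∑ u ∈ f.coeff.support with a ⬝ᵥ u = a ⬝ᵥ u₀,
      f.coeff u * (character u ξ : K) ≠ 0 := by
    refine fun h => ht₀.2 (f.coeff.support.filter fun u => a ⬝ᵥ u = a ⬝ᵥ u₀)
      (Finset.filter_ssubset.2 ⟨w₀, hw₀, hne.symm⟩) ⟨u₀, Finset.mem_filter.2 ⟨hu₀, rfl⟩⟩ ?_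
    rw [← zero_mul ((t₀ ^ (a ⬝ᵥ u₀) : Kˣ) : K), ← h, Finset.sum_mul]
    refine Finset.sum_congr rfl fun u hu => ?_
    rw [hchar, (Finset.mem_filter.1 hu).2]
  refine (hasCardLE_zeros_sum_zpow _ _ _ hM hsum).mono (fun t ht => ?_) le_rfl
  have hzero : eval (ξ * cocharacter a t) f = 0 := ht.1
  rw [eval_eq_sum] at hzero
  simpa only [Set.mem_ofPred_eq, hchar] using hzero

theorem natAbs_dotProduct_le {a u : Fin k → ℤ} {B : ℕ} (ha : ∀ i, |a i| ≤ B) :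
    (a ⬝ᵥ u).natAbs ≤ (∑ i, (u i).natAbs) * B :=
  calc (a ⬝ᵥ u).natAbs ≤ ∑ i, (a i * u i).natAbs := Int.natAbs_sum_le _ _
    _ ≤ ∑ i, (u i).natAbs * B := Finset.sum_le_sum fun i _ => by
        rw [Int.natAbs_mul, mul_comm]
        exact Nat.mul_le_mul_left _ (Int.ofNat_le.1 ((Int.abs_eq_natAbs _).symm.trans_le (ha i)))
    _ = (∑ i, (u i).natAbs) * B := (Finset.sum_mul _ _ _).symm

theorem exists_hasCardLE_properZeros_pow_mem_range {f : Laurent k K} (hf : HasFullSupport f) :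
    ∃ D : ℕ, ∀ (g : ℕ) (a : Fin k → ℤ) (B : ℕ), 0 < g → (∃ v, a ⬝ᵥ v = 1) → (∀ i, |a i| ≤ B) →
      HasCardLE {η ∈ properZeros f | η ^ g ∈ (cocharacter (K := K) a).range}
        (D * B * (g : ℝ) ^ (k - 1)) := by
  let D := f.coeff.support.sup fun u => ∑ i, (u i).natAbs
  refine ⟨2 * D, fun g a B hg ⟨v, hav⟩ hB => ?_⟩
  have ha : a ≠ 0 := by
    rintro rfl
    simp at hav
  have hD : ∀ u ∈ f.coeff.support, |a ⬝ᵥ u| ≤ (D * B : ℕ) := fun u hu => by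
    rw [Int.abs_eq_natAbs, Nat.cast_le]
    exact (natAbs_dotProduct_le hB).trans (Nat.mul_le_mul_right B
      (Finset.le_sup (f := fun u : Fin k → ℤ => ∑ i, (u i).natAbs) hu))
  let ρ (η : Torus k K) : Torus k K := η * (cocharacter a (character v η))⁻¹
  have hρ (η : Torus k K) : η = ρ η * cocharacter a (character v η) :=
    (inv_mul_cancel_right _ _).symm
  refine ((hasCardLE_pow_eq_one_and_character_eq_one (K := K) hg hav).of_fibers
    (S := {η ∈ properZeros f | η ^ g ∈ (cocharacter (K := K) a).range}) ρ ?_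
    (r := 2 * (D * B : ℕ)) (by positivity) fun ξ _ => ?_).mono subset_rfl ?_
  · rintro η ⟨-, s, hs⟩
    have hpow : cocharacter a (character v η) ^ g = η ^ g := by
      rw [← map_pow, ← map_pow, ← hs, character_cocharacter, hav, zpow_one]
    constructor
    · rw [mul_pow, inv_pow, hpow, mul_inv_cancel]
    · rw [map_mul, map_inv, character_cocharacter, hav, zpow_one, mul_inv_cancel]
  · refine (hasCardLE_mul_cocharacter_mem_properZeros hf ξ ha hD).of_injOn
      (f := character v) ?_ ?_
    · rintro η ⟨⟨hη, -⟩, rfl⟩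
      exact (hρ η).subst hη
    · rintro η ⟨-, hη⟩ η' ⟨-, hη'⟩ h
      rw [hρ η, hρ η', hη, hη', h]
  · push_cast
    exact le_of_eq (by ring)

open Classical in
/-- The primitive vectors of `ℤᵏ` with coefficients in `[-B, B]`; primitivity is encoded by a Bézout
relation, which splits the associated cocharacter. -/
noncomputable def primitiveVectors (k B : ℕ) : Finset (Fin k → ℤ) :=
  {a ∈ Fintype.piFinset fun _ => Finset.Icc (-B : ℤ) B | ∃ v, a ⬝ᵥ v = 1}

theorem mem_primitiveVectors {B : ℕ} {a : Fin k → ℤ} :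
    a ∈ primitiveVectors k B ↔ (∀ i, |a i| ≤ B) ∧ ∃ v, a ⬝ᵥ v = 1 := by
  classical
  simp only [primitiveVectors, Finset.mem_filter, Fintype.mem_piFinset, Finset.mem_Icc, abs_le]

theorem card_primitiveVectors_le (k B : ℕ) : (primitiveVectors k B).card ≤ (2 * B + 1) ^ k := by
  classical
  refine (Finset.card_filter_le _ _).trans_eq ?_
  rw [Fintype.card_piFinset_const, Int.card_Icc]
  congr 1
  omega

theorem torsionUpTo_subset_biUnion (hk : k ≠ 0) (S : Set (Torus k K)) {T Q : ℝ}
    (hQ : 2 * T ^ (1 - 1 / (k : ℝ)) ≤ Q) :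
    torsionUpTo S T ⊆ ⋃ g ∈ Finset.Icc 1 ⌊Q⌋₊, ⋃ a ∈ primitiveVectors k ⌊Q / g⌋₊,
      {η ∈ S | η ^ g ∈ (cocharacter (K := K) a).range} := by
  rintro η ⟨hη, hfin, hord⟩
  obtain ⟨g, a, hg, ⟨v, hv⟩, hga, hrange⟩ := exists_pow_mem_range_cocharacter hk hfin
  have hk1 : 1 / (k : ℝ) ≤ 1 := by
    rw [one_div]
    exact Nat.cast_inv_le_one k
  have hgaQ (i : Fin k) : (g : ℝ) * |(a i : ℝ)| ≤ Q := by
    refine ((hga i).trans ?_).trans hQ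
    gcongr
  obtain ⟨i, hi⟩ : ∃ i, a i ≠ 0 := by
    by_contra! h
    simp [dotProduct, h] at hv
  have hai : (1 : ℝ) ≤ |(a i : ℝ)| := by exact_mod_cast Int.one_le_abs hi
  refine Set.mem_biUnion (Finset.mem_Icc.2 ⟨hg, Nat.le_floor ?_⟩) (Set.mem_biUnion
    (mem_primitiveVectors.2 ⟨fun i => ?_, v, hv⟩) ⟨hη, hrange⟩)
  · exact (le_mul_of_one_le_right g.cast_nonneg hai).trans (hgaQ i)
  · rw [Int.abs_eq_natAbs, Nat.cast_le]
    refine Nat.le_floor ?_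
    rw [le_div_iff₀ (Nat.cast_pos.2 hg), Nat.cast_natAbs, Int.cast_abs, mul_comm]
    exact hgaQ i

theorem two_mul_add_one_pow_mul_le (hk : k ≠ 0) {D B g Q : ℝ} (hD : 0 ≤ D) (hB : 0 ≤ B)
    (hg : 0 < g) (hgQ : g ≤ Q) (hBQ : B ≤ Q / g) :
    (2 * B + 1) ^ k * (D * B * g ^ (k - 1)) ≤ 3 ^ k * D * Q ^ (k + 1) * (1 / g ^ 2) := by
  have hone : 1 ≤ Q / g := (one_le_div hg).2 hgQ
  have hthree : 2 * B + 1 ≤ 3 * (Q / g) := by linarith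
  obtain ⟨l, rfl⟩ := Nat.exists_eq_succ_of_ne_zero hk
  rw [Nat.succ_eq_add_one, Nat.add_sub_cancel]
  calc (2 * B + 1) ^ (l + 1) * (D * B * g ^ l)
      ≤ (3 * (Q / g)) ^ (l + 1) * (D * (Q / g) * g ^ l) := by gcongr
    _ = 3 ^ (l + 1) * D * Q ^ (l + 1 + 1) * (1 / g ^ 2) := by
        rw [mul_pow, div_pow]
        field_simp
        ring

theorem hasTorsionGrowth_properZeros (hk : k ≠ 0) {f : Laurent k K} (hf : HasFullSupport f) :
    HasTorsionGrowth (properZeros f) ((k : ℝ) - 1 / k) := by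
  obtain ⟨D, hD⟩ := exists_hasCardLE_properZeros_pow_mem_range hf
  let Z : ℝ := ∑' g : ℕ, 1 / (g : ℝ) ^ 2
  refine ⟨3 ^ k * D * 2 ^ (k + 1) * Z, fun T hT => ?_⟩
  have hT0 : 0 < T := one_pos.trans_le hT
  let Q : ℝ := 2 * T ^ (1 - 1 / (k : ℝ))
  have hQ0 : 0 ≤ Q := by positivity
  have hQ : Q ^ (k + 1) = 2 ^ (k + 1) * T ^ ((k : ℝ) - 1 / k) := by
    have hk0 : (k : ℝ) ≠ 0 := Nat.cast_ne_zero.2 hk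
    rw [mul_pow, ← Real.rpow_mul_natCast hT0.le]
    congr 2
    push_cast
    field_simp
    ring
  refine (HasCardLE.biUnion (r := fun g : ℕ => 3 ^ k * D * Q ^ (k + 1) * (1 / (g : ℝ) ^ 2))
    fun g hg => ?_).mono (torsionUpTo_subset_biUnion hk _ le_rfl) ?_
  · obtain ⟨hg1, hgQ⟩ := Finset.mem_Icc.1 hg
    refine (HasCardLE.biUnion fun a ha => hD g a ⌊Q / g⌋₊ hg1 (mem_primitiveVectors.1 ha).2
      (mem_primitiveVectors.1 ha).1).mono subset_rfl ?_
    rw [Finset.sum_const, nsmul_eq_mul]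
    refine le_trans ?_ (two_mul_add_one_pow_mul_le hk D.cast_nonneg ⌊Q / g⌋₊.cast_nonneg
      (Nat.cast_pos.2 hg1) ((Nat.le_floor_iff hQ0).1 hgQ) (Nat.floor_le (by positivity)))
    gcongr
    exact_mod_cast card_primitiveVectors_le k _
  · calc ∑ g ∈ Finset.Icc 1 ⌊Q⌋₊, 3 ^ k * D * Q ^ (k + 1) * (1 / (g : ℝ) ^ 2)
        = 3 ^ k * D * Q ^ (k + 1) * ∑ g ∈ Finset.Icc 1 ⌊Q⌋₊, 1 / (g : ℝ) ^ 2 :=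
          (Finset.mul_sum _ _ _).symm
      _ ≤ 3 ^ k * D * Q ^ (k + 1) * Z := by
          gcongr
          exact (Real.summable_one_div_nat_pow.2 one_lt_two).sum_le_tsum _
            fun g _ => by positivity
      _ = 3 ^ k * D * 2 ^ (k + 1) * Z * T ^ ((k : ℝ) - 1 / k) := by rw [hQ]; ring

end ProperZeros

section ConstantCharacters

variable {n k : ℕ} {X : Set (Torus n K)}

/-- The lattice of exponents of the monomials that are constant on `X`. For irreducible closed `X`
containing a torsion point it decides whether `X` is a torsion coset. -/
def constLattice (X : Set (Torus n K)) : Submodule ℤ (Fin n → ℤ) where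
  carrier := {u | ∀ x ∈ X, ∀ y ∈ X, character u x = character u y}
  add_mem' hu hv x hx y hy := by
    rw [character_add, character_add, hu x hx y hy, hv x hx y hy]
  zero_mem' x _ y _ := by simp
  smul_mem' c u hu x hx y hy := by rw [character_zsmul, character_zsmul, hu x hx y hy]

theorem mem_constLattice_of_finite (hirr : IsIrreducible X) {u : Fin n → ℤ}
    (h : (character u '' X).Finite) : u ∈ constLattice X := by
  have := vanishingIdeal_isPrime hirr
  have hprod : ∏ r ∈ h.toFinset, (AddMonoidAlgebra.single u (1 : K) -
      algebraMap K (Laurent n K) (r : K)) ∈ vanishingIdeal X := fun x hx => by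
    rw [map_prod]
    exact Finset.prod_eq_zero (h.mem_toFinset.2 (Set.mem_image_of_mem _ hx)) (by simp)
  obtain ⟨r, -, hr⟩ := (Ideal.IsPrime.prod_mem_iff).1 hprod
  have hconst : ∀ x ∈ X, character u x = r := fun x hx =>
    Units.ext (by simpa [sub_eq_zero] using hr x hx)
  exact fun x hx y hy => (hconst x hx).trans (hconst y hy).symm

theorem mem_constLattice_of_not_indep (hirr : IsIrreducible X) {A : Fin 1 → Fin n → ℤ}
    (hA : ¬ Indep X A) : A 0 ∈ constLattice X := by
  simp only [Indep, not_forall] at hA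
  obtain ⟨f, hfX, hf⟩ := hA
  obtain ⟨P, hP, M, hM⟩ := exists_hasCardLE_zeros_snoc hf
  have hP1 : eval 1 P ≠ 0 := fun h => hP <| indep_of_nonempty hirr.1 (Fin.elim0) P fun x _ => by
    rw [Subsingleton.elim (monomialMap _ x) 1, h]
  refine mem_constLattice_of_finite hirr ((hM 1 hP1).1.subset ?_)
  rintro _ ⟨x, hx, rfl⟩
  have hsnoc : (Fin.snoc (1 : Torus 0 K) (character (A 0) x) : Torus 1 K) = monomialMap A x := by
    funext i
    rw [Fin.eq_zero i]
    rfl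
  exact (congrArg (eval · f) hsnoc).trans (hfX x hx)

theorem mem_constLattice_of_smul_mem (hirr : IsIrreducible X) {c : ℤ} (hc : c ≠ 0)
    {u : Fin n → ℤ} (hu : c • u ∈ constLattice X) : u ∈ constLattice X := by
  obtain ⟨x₀, hx₀⟩ := hirr.1
  refine mem_constLattice_of_finite hirr
    (((hasCardLE_pow_eq_one (K := K) (Int.natAbs_pos.2 hc)).1.image (· * character u x₀)).subset ?_)
  rintro _ ⟨x, hx, rfl⟩
  refine ⟨character u x / character u x₀, ?_, div_mul_cancel _ _⟩
  have hpow : (character u x / character u x₀) ^ c = 1 := by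
    rw [div_zpow, ← character_zsmul, ← character_zsmul, hu x hx x₀ hx₀, div_self']
  exact pow_natAbs_eq_one.2 hpow

theorem exists_linearIndependent_mkQ_constLattice (hirr : IsIrreducible X) :
    ∃ (k : ℕ) (A : Fin k → Fin n → ℤ),
      LinearIndependent ℤ (fun i => (constLattice X).mkQ (A i)) ∧
      ∀ u, ∃ w : Fin k → ℤ, u - ∑ i, w i • A i ∈ constLattice X := by
  have : Module.IsTorsionFree ℤ ((Fin n → ℤ) ⧸ constLattice X) := by
    refine Module.isTorsionFree_iff_smul_eq_zero.2 fun c q hcq =>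
      or_iff_not_imp_left.2 fun hc => ?_
    obtain ⟨u, rfl⟩ := (constLattice X).mkQ_surjective q
    rw [← map_smul, Submodule.mkQ_apply, Submodule.Quotient.mk_eq_zero] at hcq
    exact (Submodule.Quotient.mk_eq_zero _).2 (mem_constLattice_of_smul_mem hirr hc hcq)
  have : Module.Free ℤ ((Fin n → ℤ) ⧸ constLattice X) := Module.free_of_finite_type_torsion_free'
  let b := Module.finBasis ℤ ((Fin n → ℤ) ⧸ constLattice X)
  choose A hA using fun i => (constLattice X).mkQ_surjective (b i)
  refine ⟨_, A, by simpa only [hA] using b.linearIndependent,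
    fun u => ⟨b.repr ((constLattice X).mkQ u), ?_⟩⟩
  rw [← Submodule.Quotient.mk_eq_zero, ← Submodule.mkQ_apply, map_sub, map_sum]
  simp only [map_smul, hA, b.sum_repr, sub_self]

theorem exists_eval_monomialMap_eq {Λ : Submodule ℤ (Fin n → ℤ)} {A : Fin k → Fin n → ℤ}
    (hA : ∀ u, ∃ w : Fin k → ℤ, u - ∑ i, w i • A i ∈ Λ) (ζ : Torus n K) (P : Laurent n K) :
    ∃ Q : Laurent k K, ∀ y, (∀ u ∈ Λ, character u y = character u ζ) →
      eval (monomialMap A y) Q = eval y P := by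
  choose w hw using hA
  refine ⟨∑ u ∈ P.coeff.support, AddMonoidAlgebra.single (w u)
    (P.coeff u * (character (u - ∑ i, w u i • A i) ζ : K)), fun y hy => ?_⟩
  rw [eval_eq_sum _ P, map_sum]
  refine Finset.sum_congr rfl fun u _ => ?_
  rw [eval_single, character_monomialMap, ← hy _ (hw u), mul_assoc, ← Units.val_mul,
    ← character_add, sub_add_cancel]

theorem eq_of_indep_of_constLattice (hX : IsClosed X) {ζ : Torus n K} (hζ : ζ ∈ X)
    {A : Fin k → Fin n → ℤ} (hA : ∀ u, ∃ w : Fin k → ℤ, u - ∑ i, w i • A i ∈ constLattice X)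
    (hind : Indep X A) : X = {y | ∀ u ∈ constLattice X, character u y = character u ζ} := by
  refine Set.Subset.antisymm (fun y hy u hu => hu y hy ζ hζ) fun y hy =>
    mem_of_forall_mem_vanishingIdeal hX fun P hP => ?_
  obtain ⟨Q, hQ⟩ := exists_eval_monomialMap_eq hA ζ P
  have hQ0 : Q = 0 := hind Q fun x hx => (hQ x fun u hu => hu x hx ζ hζ).trans (hP x hx)
  rw [← hQ y hy, hQ0, map_zero]

/-- The algebraic subgroup cut out by the characters with exponents in `Λ`; in the proof `Λ` is
`constLattice X` and the subgroup is the translate of `X` through the identity. -/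
def annihilator (Λ : Submodule ℤ (Fin n → ℤ)) : Subgroup (Torus n K) :=
  ⨅ u ∈ Λ, (character u).ker

theorem mem_annihilator {Λ : Submodule ℤ (Fin n → ℤ)} {x : Torus n K} :
    x ∈ annihilator Λ ↔ ∀ u ∈ Λ, character u x = 1 := by
  simp only [annihilator, Subgroup.mem_iInf, MonoidHom.mem_ker]

theorem isAlgebraic_annihilator (Λ : Submodule ℤ (Fin n → ℤ)) :
    IsAlgebraic ((annihilator Λ : Subgroup (Torus n K)) : Set (Torus n K)) := by
  convert isAlgebraic_zeroLocus
    ((fun u : Fin n → ℤ => AddMonoidAlgebra.single u (1 : K) - 1) '' (Λ : Set (Fin n → ℤ))) using 1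
  ext x
  simp [mem_annihilator, sub_eq_zero]

theorem isTorsionCoset_of_eq (hirr : IsIrreducible X) {ζ : Torus n K} (hfin : IsOfFinOrder ζ)
    {Λ : Submodule ℤ (Fin n → ℤ)}
    (hX : X = {y | ∀ u ∈ Λ, character u y = character u ζ}) : IsTorsionCoset X := by
  have hmem (y : Torus n K) : ζ * y ∈ X ↔ y ∈ annihilator Λ := by
    simp [hX, mem_annihilator]
  have hG : ((annihilator Λ : Subgroup (Torus n K)) : Set (Torus n K)) =
      (fun x => ζ⁻¹ * x) '' X := by
    rw [Set.image_mul_left, inv_inv]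
    exact Set.ext fun y => (hmem y).symm
  refine ⟨ζ, annihilator Λ, hfin, ⟨isAlgebraic_annihilator Λ, ?_⟩, ?_⟩
  · rw [hG]
    exact hirr.image _ (continuous_mul_left _).continuousOn
  · rw [hG, Set.image_image]
    simp

theorem exists_linearIndependent_not_indep (hX : IsClosed X) (hirr : IsIrreducible X)
    {ζ : Torus n K} (hζ : ζ ∈ X) (hfin : IsOfFinOrder ζ) (hcoset : ¬ IsTorsionCoset X) :
    ∃ (k : ℕ) (A : Fin k → Fin n → ℤ),
      LinearIndependent ℤ (fun i => (constLattice X).mkQ (A i)) ∧ ¬ Indep X A := by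
  obtain ⟨k, A, hA, hspan⟩ := exists_linearIndependent_mkQ_constLattice hirr
  exact ⟨k, A, hA, fun hind =>
    hcoset (isTorsionCoset_of_eq hirr hfin (eq_of_indep_of_constLattice hX hζ hspan hind))⟩

end ConstantCharacters

section MinimalRelations

variable {n k : ℕ} {X : Set (Torus n K)} {A : Fin k → Fin n → ℤ}

theorem finrank_ker_dotProductBilin_lt {a : Fin k → ℤ} (ha : a ≠ 0) :
    Module.finrank ℤ (LinearMap.ker (dotProductBilin ℤ ℤ a)) < k := by
  have hquot : 0 < Module.finrank ℤ ((Fin k → ℤ) ⧸ LinearMap.ker (dotProductBilin ℤ ℤ a)) := by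
    obtain ⟨i, hi⟩ := Function.ne_iff.1 ha
    rw [(LinearMap.quotKerEquivRange _).finrank_eq]
    refine Module.finrank_pos_iff_exists_ne_zero.2 ⟨⟨_, Pi.single i 1, rfl⟩, fun h => hi ?_⟩
    simpa using congrArg Subtype.val h
  have hrank := (LinearMap.ker (dotProductBilin ℤ ℤ a)).finrank_quotient_add_finrank
  rw [Module.finrank_fin_fun] at hrank
  omega

theorem exists_linearIndependent_sum_smul_eq {R E : Type*} [CommRing R] [IsDomain R]
    [IsPrincipalIdealRing R] [AddCommGroup E] [Module R E] [Module.Free R E] [Module.Finite R E]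
    (L : Submodule R E) :
    ∃ M : Fin (Module.finrank R L) → E, LinearIndependent R M ∧
      ∀ v ∈ L, ∃ w : Fin (Module.finrank R L) → R, ∑ l, w l • M l = v := by
  let b := Module.finBasis R L
  refine ⟨fun l => b l, b.linearIndependent.map' _ L.ker_subtype,
    fun v hv => ⟨b.repr ⟨v, hv⟩, ?_⟩⟩
  simpa only [Submodule.coe_sum, Submodule.coe_smul] using
    congrArg Subtype.val (b.sum_repr ⟨v, hv⟩)

theorem exists_basis_dotProduct_eq_zero {a : Fin k → ℤ} (ha : a ≠ 0) :
    ∃ r < k, ∃ M : Fin r → Fin k → ℤ, LinearIndependent ℤ M ∧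
      ∀ v, a ⬝ᵥ v = 0 → ∃ w : Fin r → ℤ, ∑ l, w l • M l = v := by
  obtain ⟨M, hM, hspan⟩ :=
    exists_linearIndependent_sum_smul_eq (LinearMap.ker (dotProductBilin ℤ ℤ a))
  exact ⟨_, finrank_ker_dotProductBilin_lt ha, M, hM,
    fun v hv => hspan v (LinearMap.mem_ker.2 hv)⟩

theorem exists_eq_single_mul_monomialSubst {r : ℕ} {M : Fin r → Fin k → ℤ} (f : Laurent k K)
    (v₀ : Fin k → ℤ) (h : ∀ v ∈ f.coeff.support, ∃ w : Fin r → ℤ, ∑ l, w l • M l = v - v₀) :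
    ∃ g : Laurent r K, f = AddMonoidAlgebra.single v₀ 1 * monomialSubst M g := by
  choose! w hw using h
  refine ⟨∑ v ∈ f.coeff.support, AddMonoidAlgebra.single (w v) (f.coeff v), ?_⟩
  rw [map_sum, Finset.mul_sum]
  conv_lhs => rw [← AddMonoidAlgebra.sum_coeff_single f]
  refine Finset.sum_congr rfl fun v hv => ?_
  rw [monomialSubst_single, hw v hv, AddMonoidAlgebra.single_mul_single, add_sub_cancel, one_mul]

theorem linearIndependent_mkQ_sum {Λ : Submodule ℤ (Fin n → ℤ)} {r : ℕ} {M : Fin r → Fin k → ℤ}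
    (hM : LinearIndependent ℤ M) (hA : LinearIndependent ℤ fun i => Λ.mkQ (A i)) :
    LinearIndependent ℤ fun l => Λ.mkQ (∑ i, M l i • A i) := by
  have h := hM.map' _ (LinearMap.ker_eq_bot.2 hA.fintypeLinearCombination_injective)
  simpa only [Function.comp_def, Fintype.linearCombination_apply, map_sum, map_smul] using h

theorem exists_lt_not_indep_of_not_hasFullSupport
    (hA : LinearIndependent ℤ fun i => (constLattice X).mkQ (A i)) {f : Laurent k K} (hf : f ≠ 0)
    (hfX : ∀ x ∈ X, eval (monomialMap A x) f = 0) (hsupp : ¬ HasFullSupport f) :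
    ∃ r < k, ∃ A' : Fin r → Fin n → ℤ,
      LinearIndependent ℤ (fun i => (constLattice X).mkQ (A' i)) ∧ ¬ Indep X A' := by
  simp only [HasFullSupport, not_forall] at hsupp
  obtain ⟨a, ha, hconst⟩ := hsupp
  push Not at hconst
  obtain ⟨r, hr, M, hM, hspan⟩ := exists_basis_dotProduct_eq_zero ha
  obtain ⟨v₀, hv₀⟩ : f.coeff.support.Nonempty := Finsupp.support_nonempty_iff.2 (by simpa using hf)
  obtain ⟨g, hg⟩ := exists_eq_single_mul_monomialSubst f v₀ fun v hv =>
    hspan (v - v₀) (by rw [dotProduct_sub, hconst v hv v₀ hv₀, sub_self])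
  refine ⟨r, hr, fun l => ∑ i, M l i • A i, linearIndependent_mkQ_sum hM hA, fun hind => hf ?_⟩
  have hg0 : g = 0 := hind g fun x hx => by
    have hmap : monomialMap (fun l => ∑ i, M l i • A i) x = monomialMap M (monomialMap A x) :=
      funext fun l => (character_monomialMap x A (M l)).symm
    have hx := hfX x hx
    rw [hg, map_mul, eval_single, eval_monomialSubst, one_mul] at hx
    rw [hmap]
    exact (mul_eq_zero.1 hx).resolve_left (Units.ne_zero _)
  rw [hg, hg0, map_zero, mul_zero]

theorem exists_minimal_relation (hA : ¬ Indep X A) :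
    ∃ f : Laurent k K, f ≠ 0 ∧ (∀ x ∈ X, eval (monomialMap A x) f = 0) ∧
      ∀ s ⊂ f.coeff.support, s.Nonempty →
        ∃ x ∈ X, eval (monomialMap A x) (∑ v ∈ s, AddMonoidAlgebra.single v (f.coeff v)) ≠ 0 := by
  classical
  simp only [Indep, not_forall] at hA
  obtain ⟨f₀, hf₀X, hf₀⟩ := hA
  obtain ⟨f, ⟨hf, hfX⟩, hmin⟩ := (measure fun f : Laurent k K => f.coeff.support.card).wf.has_min
    {f | f ≠ 0 ∧ ∀ x ∈ X, eval (monomialMap A x) f = 0} ⟨f₀, hf₀, hf₀X⟩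
  refine ⟨f, hf, hfX, fun s hs ⟨v₀, hv₀⟩ => ?_⟩
  by_contra! hsX
  set h : Laurent k K := ∑ v ∈ s, AddMonoidAlgebra.single v (f.coeff v) with hh
  have hcoeff (v : Fin k → ℤ) : h.coeff v = if v ∈ s then f.coeff v else 0 := by
    simp [hh, AddMonoidAlgebra.coeff_sum, Finsupp.single_apply]
  have hsupp : h.coeff.support ⊆ s := fun v hv => by
    by_contra hvs
    simp [hcoeff, hvs] at hv
  refine hmin h ⟨fun h0 => Finsupp.mem_support_iff.1 (hs.subset hv₀) ?_, hsX⟩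
    ((Finset.card_le_card hsupp).trans_lt (Finset.card_lt_card hs))
  simpa [h0, hv₀] using (hcoeff v₀).symm

theorem exists_monomialMap_mem_properZeros (hX : IsClosed X) (hirr : IsIrreducible X)
    (hA : ¬ Indep X A) :
    ∃ f : Laurent k K, f ≠ 0 ∧ (∀ x ∈ X, eval (monomialMap A x) f = 0) ∧
      ∃ Y, IsClosed Y ∧ Y ⊂ X ∧ ∀ x ∈ X \ Y, monomialMap A x ∈ properZeros f := by
  classical
  obtain ⟨f, hf, hfX, hproper⟩ := exists_minimal_relation hA
  let Q : Laurent n K := ∏ s ∈ f.coeff.support.ssubsets with s.Nonempty,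
    monomialSubst A (∑ v ∈ s, AddMonoidAlgebra.single v (f.coeff v))
  have hQ : Q ∉ vanishingIdeal X := fun h => by
    have := vanishingIdeal_isPrime hirr
    obtain ⟨s, hs, hsX⟩ := Ideal.IsPrime.prod_mem_iff.1 h
    rw [Finset.mem_filter, Finset.mem_ssubsets] at hs
    obtain ⟨x, hx, hne⟩ := hproper s hs.1 hs.2
    exact hne ((eval_monomialSubst x A _).symm.trans (hsX x hx))
  refine ⟨f, hf, hfX, X ∩ {x | eval x Q = 0}, hX.inter (isClosed_zeros Q),
    ⟨Set.inter_subset_left, fun h => hQ fun x hx => (h hx).2⟩,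
    fun x ⟨hx, hxY⟩ => ⟨hfX x hx, fun s hs hne h0 => hxY ⟨hx, ?_⟩⟩⟩
  change eval x Q = 0
  rw [map_prod]
  refine Finset.prod_eq_zero (Finset.mem_filter.2 ⟨Finset.mem_ssubsets.2 hs, hne⟩) ?_
  rw [eval_monomialSubst, map_sum]
  simpa only [eval_single] using h0

theorem exists_minimal_dependent (hX : IsClosed X) (hirr : IsIrreducible X)
    {ζ : Torus n K} (hζ : ζ ∈ X) (hfin : IsOfFinOrder ζ) (hcoset : ¬ IsTorsionCoset X) :
    ∃ p > 0, ∃ A : Fin (p + 1) → Fin n → ℤ, ¬ Indep X A ∧ Indep X (fun i : Fin p => A i.castSucc) ∧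
      ∀ f ≠ 0, (∀ x ∈ X, eval (monomialMap A x) f = 0) → HasFullSupport f := by
  classical
  have hex := exists_linearIndependent_not_indep hX hirr hζ hfin hcoset
  obtain ⟨A, hA, hdep⟩ := Nat.find_spec hex
  have hmin := fun r => Nat.find_min (m := r) hex
  generalize Nat.find hex = k at A hmin
  obtain _ | _ | p := k
  · exact absurd (indep_of_nonempty hirr.1 A) hdep
  · exact absurd ((Submodule.Quotient.mk_eq_zero _).2 (mem_constLattice_of_not_indep hirr hdep))
      (hA.ne_zero 0)
  refine ⟨p + 1, p.succ_pos, A, hdep, ?_, fun f hf hfX => ?_⟩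
  · by_contra hinit
    exact hmin (p + 1) (Nat.lt_succ_self _)
      ⟨_, hA.comp Fin.castSucc (Fin.castSucc_injective _), hinit⟩
  · by_contra hsupp
    obtain ⟨r, hr, hA'⟩ := exists_lt_not_indep_of_not_hasFullSupport hA hf hfX hsupp
    exact hmin r hr hA'

end MinimalRelations

section Counting

variable {n k : ℕ} {X Y : Set (Torus n K)}

theorem HasTorsionGrowth.exists_hasCardLE_pairs {e : ℝ} (hX : HasTorsionGrowth X e) (he : 1 < e) :
    ∃ c : ℝ, ∀ T : ℝ, 1 ≤ T →
      HasCardLE {q : ℕ × Torus n K | 0 < q.1 ∧ q.1 ≤ T ∧ q.2 ∈ X ∧ q.2 ^ q.1 = 1} (c * T ^ e) := by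
  obtain ⟨c, hc⟩ := hX
  have hc0 : 0 ≤ c := by simpa using (hc 1 le_rfl).nonneg
  have hsum : Summable fun j : ℕ => 1 / (j : ℝ) ^ e := Real.summable_one_div_nat_rpow.2 he
  refine ⟨c * ∑' j : ℕ, 1 / (j : ℝ) ^ e, fun T hT => ?_⟩
  have hT0 : 0 ≤ T := zero_le_one.trans hT
  refine (HasCardLE.biUnion (s := Finset.Icc 1 ⌊T⌋₊)
    (f := fun j => {q : ℕ × Torus n K | q.1 = orderOf q.2 * j ∧ q.2 ∈ torsionUpTo X (T / j)})
    (r := fun j => c * T ^ e * (1 / (j : ℝ) ^ e)) fun j hj => ?_).mono ?_ ?_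
  · obtain ⟨hj1, hjT⟩ := Finset.mem_Icc.1 hj
    have hj0 : (0 : ℝ) < j := Nat.cast_pos.2 hj1
    refine ((hc (T / j) ((one_le_div hj0).2 ((Nat.le_floor_iff hT0).1 hjT))).of_injOn
      (f := Prod.snd) (fun q hq => hq.2) fun q hq q' hq' h => ?_).mono subset_rfl ?_
    · exact Prod.ext (by rw [hq.1, hq'.1, h]) h
    · rw [Real.div_rpow hT0 hj0.le, mul_assoc, mul_one_div]
  · rintro ⟨N, y⟩ ⟨hN : 0 < N, hNT : N ≤ T, hy, hyN : y ^ N = 1⟩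
    obtain ⟨j, rfl⟩ := orderOf_dvd_of_pow_eq_one hyN
    have hj : 0 < j := Nat.pos_of_mul_pos_left hN
    have ho : 0 < orderOf y := Nat.pos_of_mul_pos_right hN
    refine Set.mem_biUnion (Finset.mem_Icc.2 ⟨hj, Nat.le_floor (le_trans ?_ hNT)⟩)
      ⟨rfl, hy, orderOf_pos_iff.1 ho, ?_⟩
    · exact Nat.cast_le.2 (Nat.le_mul_of_pos_left j ho)
    · rw [le_div_iff₀ (Nat.cast_pos.2 hj)]
      exact_mod_cast hNT
  · rw [← Finset.mul_sum, mul_right_comm _ _ (T ^ e)]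
    exact mul_le_mul_of_nonneg_left (hsum.sum_le_tsum _ fun j _ => by positivity) (by positivity)

theorem hasCardLE_orderOf_eq_of_fibers {p m N : ℕ} (hpm : p ≤ m) {B : Fin m → Fin n → ℤ} {C : ℝ}
    (hC : ∀ z, HasCardLE {x ∈ X | monomialMap B x = z} C) (hN : 0 < N) (y : Torus p K) :
    HasCardLE {x ∈ X | orderOf x = N ∧ ∀ i, character (B (Fin.castLE hpm i)) x = y i}
      ((N : ℝ) ^ (m - p) * C) := by
  refine (hasCardLE_pow_eq_one_of_castLE_eq hpm y hN).of_fibers (monomialMap B) ?_ (hC 1).nonneg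
    fun z _ => (hC z).mono (fun x hx => ⟨hx.1.1, hx.2⟩) le_rfl
  rintro x ⟨-, rfl, hxy⟩
  exact ⟨by rw [← map_pow, pow_orderOf_eq_one, map_one], hxy⟩

theorem hasTorsionGrowth_of_monomialMap_mem_properZeros {p m : ℕ} (hp : 0 < p) (hpm : p ≤ m)
    {A : Fin (p + 1) → Fin n → ℤ} {B : Fin m → Fin n → ℤ}
    (hBA : ∀ i, B (Fin.castLE hpm i) = A i.castSucc) {C : ℝ}
    (hC : ∀ z, HasCardLE {x ∈ X | monomialMap B x = z} C) {f : Laurent (p + 1) K}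
    (hf : HasFullSupport f) (hX : ∀ x ∈ X, monomialMap A x ∈ properZeros f) :
    HasTorsionGrowth X ((m : ℝ) + 1 - 1 / ((p : ℝ) + 1)) := by
  have he : 1 < ((p + 1 : ℕ) : ℝ) - 1 / ((p + 1 : ℕ) : ℝ) := by
    have hp' : (1 : ℝ) ≤ p := Nat.one_le_cast.2 hp
    have : 1 / ((p : ℝ) + 1) < 1 := (div_lt_one (by linarith)).2 (by linarith)
    push_cast
    linarith
  obtain ⟨c, hc⟩ := (hasTorsionGrowth_properZeros p.succ_ne_zero hf).exists_hasCardLE_pairs he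
  have hC0 : 0 ≤ C := (hC 1).nonneg
  refine ⟨c * C, fun T hT => ?_⟩
  have hT0 : 0 < T := one_pos.trans_le hT
  refine ((hc T hT).of_fibers (fun x => (orderOf x, monomialMap A x)) ?_
    (r := T ^ (m - p) * C) (by positivity) ?_).mono subset_rfl ?_
  · rintro x ⟨hx, hfin, hxT⟩
    exact ⟨hfin.orderOf_pos, hxT, hX x hx, by
      rw [← map_pow, pow_orderOf_eq_one, map_one]⟩
  · rintro ⟨N, y⟩ ⟨hN, hNT, -, -⟩
    refine (hasCardLE_orderOf_eq_of_fibers hpm hC hN fun i => y i.castSucc).mono ?_ ?_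
    · rintro x ⟨hx, hxy⟩
      obtain ⟨rfl, rfl⟩ := Prod.mk.inj hxy
      exact ⟨hx.1, rfl, fun i => by rw [hBA, monomialMap_apply]⟩
    · exact mul_le_mul_of_nonneg_right (pow_le_pow_left₀ (Nat.cast_nonneg N) hNT _) hC0
  · rw [show (m : ℝ) + 1 - 1 / ((p : ℝ) + 1) =
      ((p + 1 : ℕ) : ℝ) - 1 / ((p + 1 : ℕ) : ℝ) + (m - p : ℕ) by
        rw [Nat.cast_sub hpm]; push_cast; ring, Real.rpow_add hT0, Real.rpow_natCast]
    exact le_of_eq (by ring)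

theorem hasTorsionGrowth_of_ssubset [IsAlgClosed K] (hirr : IsIrreducible X) {d : ℕ}
    (hd : dim X = d) (hY : IsClosed Y) (hYX : Y ⊂ X) : HasTorsionGrowth Y d := by
  refine hasTorsionGrowth_of_dim_lt hY (lt_of_not_ge fun hle => ?_)
  have h := (add_le_add_left hle 1).trans (dim_add_one_le hirr hY hYX)
  rw [hd] at h
  exact d.not_succ_le_self (mod_cast h)

theorem hasTorsionGrowth_of_not_isTorsionCoset [IsAlgClosed K] (hX : IsClosed X)
    (hirr : IsIrreducible X) (hcoset : ¬ IsTorsionCoset X) {d : ℕ} (hd : dim X = d)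
    {ζ : Torus n K} (hζ : ζ ∈ X) (hfin : IsOfFinOrder ζ) :
    HasTorsionGrowth X ((d : ℝ) + 1 - 1 / ((d : ℝ) + 1)) := by
  obtain ⟨p, hp, A, hdep, hinit, hfull⟩ := exists_minimal_dependent hX hirr hζ hfin hcoset
  obtain ⟨f, hf, hfX, Y, hY, hYX, hproper⟩ := exists_monomialMap_mem_properZeros hX hirr hdep
  obtain ⟨m, hpm, B, hmd, hBA, hB, hmax⟩ := exists_maximal_indep hX hirr hd.le hinit
  obtain ⟨C, Z, hZ, hZX, hC⟩ := exists_hasCardLE_fiber hX hB hmax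
  have hgeneric : HasTorsionGrowth (X \ (Y ∪ Z)) ((m : ℝ) + 1 - 1 / ((p : ℝ) + 1)) :=
    hasTorsionGrowth_of_monomialMap_mem_properZeros hp hpm hBA
      (fun z => (hC z).mono (fun x hx => ⟨⟨hx.1.1, fun h => hx.1.2 (.inr h)⟩, hx.2⟩) le_rfl)
      (hfull f hf hfX) fun x hx => hproper x ⟨hx.1, fun h => hx.2 (.inl h)⟩
  have hexceptional : HasTorsionGrowth (Y ∪ Z) d :=
    (hasTorsionGrowth_of_ssubset hirr hd hY hYX).union (hasTorsionGrowth_of_ssubset hirr hd hZ hZX)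
  have hpd : (p : ℝ) ≤ d := Nat.cast_le.2 (hpm.trans hmd)
  have hm : (m : ℝ) ≤ d := Nat.cast_le.2 hmd
  have hinv : 1 / ((d : ℝ) + 1) ≤ 1 / ((p : ℝ) + 1) :=
    one_div_le_one_div_of_le (by positivity) (by linarith)
  have hone : 1 / ((d : ℝ) + 1) ≤ 1 := (div_le_one (by positivity)).2 (by linarith)
  exact ((hgeneric.mono subset_rfl (by linarith)).union
    (hexceptional.mono subset_rfl (by linarith))).mono (by simp) le_rfl

end Counting

end GmTorsion

theorem theorem7 {K : Type*} [Field K] [IsAlgClosed K] {n : ℕ}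
    (X : Set (GmTorsion.Torus n K)) (halg : GmTorsion.IsAlgebraic X) (hirr : IsIrreducible X)
    (hadm : GmTorsion.IsAdmissible X) (d : ℕ) (hd : GmTorsion.dim X = d) :
    ∃ c : ℝ, ∀ T : ℝ, 1 ≤ T →
      (GmTorsion.torsionUpTo X T).Finite ∧
        ((GmTorsion.torsionUpTo X T).ncard : ℝ) ≤ c * T ^ ((d : ℝ) + 1 - 1 / ((d : ℝ) + 1)) := by
  rcases hadm with hfinite | ⟨-, hadm⟩
  · refine GmTorsion.HasTorsionGrowth.of_finite hfinite ?_
    have : 1 / ((d : ℝ) + 1) ≤ 1 := (div_le_one (by positivity)).2 (by simp)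
    linarith [d.cast_nonneg (α := ℝ)]
  · by_cases! htor : ∃ ζ ∈ X, IsOfFinOrder ζ
    · obtain ⟨ζ, hζ, hfin⟩ := htor
      exact GmTorsion.hasTorsionGrowth_of_not_isTorsionCoset
        ((GmTorsion.isClosed_iff X).2 halg) hirr (fun hX => hadm X hX subset_rfl rfl) hd hζ hfin
    · have hempty (T : ℝ) : GmTorsion.torsionUpTo X T = ∅ :=
        Set.eq_empty_of_forall_notMem fun x hx => htor x hx.1 hx.2.1
      exact ⟨0, fun T _ => by simp [hempty T]⟩
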